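/- An automaton $\mathcal{T}=(Q,\Sigma,\delta)$ consists of a finite non-empty state set $Q$, a finite non-empty alphabet $\Sigma$ and a set of transitions $\delta\subseteq Q\times\Sigma\times\Sigma\times Q$, where $(q,a,b,p)\in\delta$ is a transition from state $q$ on input $a$ with output $b$ into state $p$. It is a $G$-automaton if it is complete and deterministic (for all $q\in Q$ and $a\in\Sigma$ there is exactly one pair $(b,p)$ with $(q,a,b,p)\in\delta$) and inverse-deterministic (for all $q\in Q$ and $b\in\Sigma$ there is at most one pair $(a,p)$ with $(q,a,b,p)\in\delta$). Every state $q$ of a $G$-automaton then induces a length-preserving bijection $q\circ{}\colon\Sigma^*\to\Sigma^*$ by $q\circ\varepsilon=\varepsilon$ and $q\circ au=b\,(p\circ u)$, where $(q,a,b,p)\in\delta$. The group $\mathscr{G}(\mathcal{T})$ generated by $\mathcal{T}$ is the group of bijections of $\Sigma^*$ generated by these maps, and $$\mathcal{P}(\mathcal{T})=\{\,q_n\cdots q_1\in Q^+ \mid q_n\cdots q_1=1 \text{ in } \mathscr{G}(\mathcal{T})\,\}$$ is the set of non-empty finite sequences of states (without inverses) that act as the identity. Theorem. The following decision problem (Positive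 Relations) is undecidable: given a $G$-automaton $\mathcal{T}$ (as a finite list of its transitions, together with the numbers of its states and letters), is $\mathcal{P}(\mathcal{T})=\emptyset$? That is, there is no algorithm that halts with the correct answer on every $G$-automaton. -/

import Mathlib

/-- An automaton (synchronous finite-state transducer) with state set `Q` and with `A` as input
and output alphabet, given by its set of transitions: `(q, a, b, p) ∈ T.trans` is the transition
from state `q` on input `a` with output `b` into state `p`. -/
structure MealyAutomaton (Q A : Type) where
  /-- The transition set. -/
  trans : Set (Q × A × A × Q)

namespace MealyAutomaton

variable {Q A : Type}

/-- At most one transition for every state and every input letter. -/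
def IsDeterministic (T : MealyAutomaton Q A) : Prop :=
  ∀ q a b p b' p', (q, a, b, p) ∈ T.trans → (q, a, b', p') ∈ T.trans → b = b' ∧ p = p'

/-- At least one transition for every state and every input letter. -/
def IsComplete (T : MealyAutomaton Q A) : Prop :=
  ∀ q a, ∃ b p, (q, a, b, p) ∈ T.trans

/-- The inverse automaton: inputs and outputs are swapped. -/
def inverse (T : MealyAutomaton Q A) : MealyAutomaton Q A :=
  ⟨{t | (t.1, t.2.2.1, t.2.1, t.2.2.2) ∈ T.trans}⟩

/-- A `G`-automaton is an automaton that is complete, deterministic and inverse-deterministic. -/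
structure IsGAutomaton (T : MealyAutomaton Q A) : Prop where
  complete : T.IsComplete
  deterministic : T.IsDeterministic
  inverse_deterministic : T.inverse.IsDeterministic

/-- `T.Outputs q u v`: started in state `q`, the automaton can read the word `u` while writing the
word `v`. For deterministic `T` this is the graph of the partial function `u ↦ q ∘ u`. -/
inductive Outputs (T : MealyAutomaton Q A) : Q → List A → List A → Prop
  | nil (q : Q) : Outputs T q [] []
  | cons {q p : Q} {a b : A} {u v : List A} (h : (q, a, b, p) ∈ T.trans) (hr : Outputs T p u v) :
      Outputs T q (a :: u) (b :: v)

theorem IsComplete.exists_outputs {T : MealyAutomaton Q A} (hT : T.IsComplete) (q : Q)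
    (u : List A) : ∃ v, T.Outputs q u v := by
  induction u generalizing q with
  | nil => exact ⟨[], .nil q⟩
  | cons a u ih =>
    obtain ⟨b, p, h⟩ := hT q a
    obtain ⟨v, hv⟩ := ih p
    exact ⟨b :: v, .cons h hv⟩

theorem IsDeterministic.outputs_unique {T : MealyAutomaton Q A} (hT : T.IsDeterministic) {q : Q}
    {u v w : List A} (hv : T.Outputs q u v) (hw : T.Outputs q u w) : v = w := by
  induction hv generalizing w with
  | nil => cases hw; rfl
  | cons h _ ih =>
    cases hw with
    | cons h' hr' =>
      obtain ⟨rfl, rfl⟩ := hT _ _ _ _ _ _ h h'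
      rw [ih hr']

theorem outputs_inverse {T : MealyAutomaton Q A} {q : Q} {u v : List A} (h : T.Outputs q u v) :
    T.inverse.Outputs q v u := by
  induction h with
  | nil q => exact .nil q
  | cons h _ ih => exact .cons (show _ ∈ T.inverse.trans from h) ih

/-- Since the alphabet is finite, a `G`-automaton is also inverse-complete. -/
theorem IsGAutomaton.inverse_complete [Finite A] {T : MealyAutomaton Q A} (hT : T.IsGAutomaton) :
    T.inverse.IsComplete := by
  intro q
  choose out next h using hT.complete q
  have hinj : Function.Injective out := fun a a' e =>
    (hT.inverse_deterministic q (out a) a (next a) a' (next a') (h a)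
      (by rw [e]; exact h a')).1
  intro b
  obtain ⟨a, rfl⟩ := Finite.surjective_of_injective hinj b
  exact ⟨a, next a, h a⟩

/-- The function `u ↦ q ∘ u` on finite words. -/
noncomputable def IsGAutomaton.act {T : MealyAutomaton Q A} (hT : T.IsGAutomaton) (q : Q)
    (u : List A) : List A :=
  (hT.complete.exists_outputs q u).choose

theorem IsGAutomaton.outputs_act {T : MealyAutomaton Q A} (hT : T.IsGAutomaton) (q : Q)
    (u : List A) : T.Outputs q u (hT.act q u) :=
  (hT.complete.exists_outputs q u).choose_spec

theorem IsGAutomaton.act_bijective [Finite A] {T : MealyAutomaton Q A} (hT : T.IsGAutomaton)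
    (q : Q) : Function.Bijective (hT.act q) := by
  constructor
  · intro u v e
    have hu := outputs_inverse (hT.outputs_act q u)
    rw [e] at hu
    exact hT.inverse_deterministic.outputs_unique hu (outputs_inverse (hT.outputs_act q v))
  · intro v
    obtain ⟨u, hu⟩ := hT.inverse_complete.exists_outputs q v
    exact ⟨u, hT.deterministic.outputs_unique (hT.outputs_act q u) (outputs_inverse hu)⟩

/-- The bijection `u ↦ q ∘ u` of the set of finite words that a state of a `G`-automaton
induces. -/
noncomputable def IsGAutomaton.perm [Finite A] {T : MealyAutomaton Q A} (hT : T.IsGAutomaton)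
    (q : Q) : Equiv.Perm (List A) :=
  Equiv.ofBijective (hT.act q) (hT.act_bijective q)

/-- The group generated by a `G`-automaton: the group generated by the actions of its states. -/
noncomputable def IsGAutomaton.group [Finite A] {T : MealyAutomaton Q A} (hT : T.IsGAutomaton) :
    Subgroup (Equiv.Perm (List A)) :=
  Subgroup.closure (Set.range hT.perm)

/-- The element of the generated group given by a state. -/
noncomputable def IsGAutomaton.gen [Finite A] {T : MealyAutomaton Q A} (hT : T.IsGAutomaton)
    (q : Q) : hT.group :=
  ⟨hT.perm q, Subgroup.subset_closure (Set.mem_range_self q)⟩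

/-- The positive relations of a `G`-automaton: the nonempty state sequences (without inverses)
that are the identity in the generated group. The product of `[qₙ, …, q₁]` is `qₙ ∘ ⋯ ∘ q₁`. -/
def IsGAutomaton.positiveRelations [Finite A] {T : MealyAutomaton Q A} (hT : T.IsGAutomaton) :
    Set (List Q) :=
  {w | w ≠ [] ∧ (w.map hT.gen).prod = 1}

/-- A finite description of an automaton: the number of its states, the number of its letters, and
a list of its transitions, where states and letters are numbered from `0`. -/
abbrev Description : Type := ℕ × ℕ × List (ℕ × ℕ × ℕ × ℕ)

namespace Description

/-- There are states and letters, and the transitions use only existing ones. -/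
def WellFormed (d : Description) : Prop :=
  0 < d.1 ∧ 0 < d.2.1 ∧
    ∀ t ∈ d.2.2, t.1 < d.1 ∧ t.2.1 < d.2.1 ∧ t.2.2.1 < d.2.1 ∧ t.2.2.2 < d.1

/-- The automaton that is described. -/
def toAutomaton (d : Description) : MealyAutomaton (Fin d.1) (Fin d.2.1) :=
  ⟨{t | ((t.1 : ℕ), (t.2.1 : ℕ), (t.2.2.1 : ℕ), (t.2.2.2 : ℕ)) ∈ d.2.2}⟩

end Description

/-- The inputs of the decision problem: the descriptions of `G`-automata. -/
structure GDescription where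
  /-- The description. -/
  desc : Description
  wellFormed : desc.WellFormed
  isGAutomaton : desc.toAutomaton.IsGAutomaton

end MealyAutomaton

/-- The problem with input type `ι`, whose inputs are presented to the algorithm through
`code : ι → α`, and with yes-instances `p`, is decidable: some algorithm (a partial recursive
function) halts on every input and answers correctly. On elements of `α` that present no input
nothing is required of it, not even that it halts. -/
def DecidableProblem {ι α : Type} [Primcodable α] (code : ι → α) (p : ι → Prop) : Prop :=
  ∃ f : α →. Bool, Partrec f ∧ ∀ i : ι, ∃ answer ∈ f (code i), (answer = true ↔ p i)

/-!
The halting problem is reduced to the emptiness of the set of positive relations.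

*From machines to one equation between words.* Mathlib compiles every partial recursive function to
a machine with several stacks. Such a machine is simulated by a queue machine whose queue is a
rotation of the contents of the stacks (`QueueMachine.ofTM2`). A queue machine with initial state
`s₀` and initial queue `w` halts if and only if `w ++ output s₀ v = v` for some word `v`
(`QueueMachine.eval_dom_iff`): as long as the queue is not empty, the letters that are removed are
forced.

*From the equation to products of tiles.* Consider the right-angled Coxeter group with generators
`QueueMachine.Gen`. They form two tracks, which commute with each other, and nodes, which commute
with nothing. The subgroup generated by one track contains a free monoid on the queue letters, so
that a pair of queue words can be multiplied from the right by appended and by removed letters. A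
tile is a word `p * k * p'` with nodes `p`, `p'` and with `k` in the tracks. A product of tiles
whose nodes match along a path collapses to the product of the track parts between the two outer
nodes, and there is no other way to cancel nodes; so in a product that is equal to `1`, some path
that is closed or starts at the initial node has a trivial track part. Closed paths have a
nontrivial one, and if a path from the initial node has a trivial one, its tracks give a solution of
the equation
(`QueueMachine.Tile.halts_of_act_words`). Conversely, a solution gives a path whose product is
the generator of the final node, an involution, so that the square of this product is `1`
(`QueueMachine.Tile.exists_act_words_eq_one`).

*From tiles to automata.* The Coxeter group acts linearly on integer vectors, and a reduced nonempty
word moves the all-ones vector, because each of its letters increases the sum of the coordinates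
(`RightAngled.act_one_ne_one`). Adding carries, a finite automaton can apply an integer matrix to
vectors of two-adic integers, given by their digits. The automaton `TwoAdic.description` does this
for the matrices of all tiles. Its states act as affine maps with these linear parts, and each
linear part also occurs with carry zero; so a product of states is `1` for suitable carries if and
only if the product of the tiles is `1`. All matrices are the identity modulo two, which makes the
automaton inverse-deterministic.
-/

/-! ### The linear action of a right-angled Coxeter group -/

namespace RightAngled

section Action

variable {V : Type} [Fintype V] [DecidableEq V] (nc : V → V → Prop) [DecidableRel nc]

/-- The sum of the coordinates of `x` at the letters that do not commute with `i`. -/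
def neighborSum (i : V) : (V → ℤ) →ₗ[ℤ] ℤ :=
  ∑ j, if nc i j then LinearMap.proj j else 0

omit [DecidableEq V] in
theorem neighborSum_apply (i : V) (x : V → ℤ) :
    neighborSum nc i x = ∑ j, if nc i j then x j else 0 := by
  simp only [neighborSum, LinearMap.sum_apply]
  refine Finset.sum_congr rfl fun j _ => ?_
  split_ifs <;> simp

/-- The generator `i` acts on `ℤ^V` by replacing the coordinate `xᵢ` by
`4 * neighborSum nc i x - xᵢ`. The coefficient is even, so that the action is trivial modulo two,
and large enough for `act_one_pos`. -/
def refl (i : V) : Module.End ℤ (V → ℤ) :=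
  LinearMap.id + (LinearMap.single ℤ (fun _ : V => ℤ) i).comp
    ((4 : ℤ) • neighborSum nc i - (2 : ℤ) • LinearMap.proj i)

theorem refl_apply_self (i : V) (x : V → ℤ) :
    refl nc i x i = 4 * neighborSum nc i x - x i := by
  simp [refl]; ring

theorem refl_apply_of_ne {i j : V} (h : j ≠ i) (x : V → ℤ) : refl nc i x j = x j := by
  simp [refl, h]

/-- A word acts by the product of the actions of its letters, the last letter first. -/
def act (l : List V) : Module.End ℤ (V → ℤ) :=
  (l.map (refl nc)).prod

@[simp] theorem act_nil : act nc [] = 1 := rfl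

@[simp] theorem act_cons (a : V) (l : List V) : act nc (a :: l) = refl nc a * act nc l := by
  simp [act]

@[simp] theorem act_append (l l' : List V) : act nc (l ++ l') = act nc l * act nc l' := by
  simp [act]

/-- The letter `a` can be moved to the front of the word by commutations. -/
def Desc : List V → V → Prop
  | [], _ => False
  | b :: l, a => a = b ∨ (¬ nc a b ∧ Desc l a)

/-- No two equal letters of the word can be brought together by commutations. -/
def Reduced : List V → Prop
  | [] => True
  | a :: l => ¬ Desc nc l a ∧ Reduced l

variable (hsymm : ∀ i j, nc i j → nc j i) (hirr : ∀ i, ¬ nc i i)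

include hirr in
theorem neighborSum_refl_self (i : V) (x : V → ℤ) :
    neighborSum nc i (refl nc i x) = neighborSum nc i x := by
  rw [neighborSum_apply, neighborSum_apply]
  refine Finset.sum_congr rfl fun j _ => ?_
  split_ifs with h
  · exact refl_apply_of_ne nc (by rintro rfl; exact hirr _ h) x
  · rfl

theorem neighborSum_refl_of_not {i j : V} (h : ¬ nc i j) (x : V → ℤ) :
    neighborSum nc i (refl nc j x) = neighborSum nc i x := by
  rw [neighborSum_apply, neighborSum_apply]
  refine Finset.sum_congr rfl fun k _ => ?_
  split_ifs with h'
  · exact refl_apply_of_ne nc (by rintro rfl; exact h h') x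
  · rfl

include hirr in
theorem refl_mul_self (i : V) : refl nc i * refl nc i = 1 := by
  refine LinearMap.ext fun x => funext fun j => ?_
  rw [Module.End.mul_apply, Module.End.one_apply]
  by_cases h : j = i
  · subst h
    rw [refl_apply_self, refl_apply_self, neighborSum_refl_self nc hirr]; ring
  · rw [refl_apply_of_ne nc h, refl_apply_of_ne nc h]

include hsymm in
theorem refl_comm {i j : V} (h : ¬ nc i j) : refl nc i * refl nc j = refl nc j * refl nc i := by
  by_cases hij : i = j
  · rw [hij]
  have h' : ¬ nc j i := fun h' => h (hsymm _ _ h')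
  refine LinearMap.ext fun x => funext fun k => ?_
  rw [Module.End.mul_apply, Module.End.mul_apply]
  by_cases hi : k = i
  · subst hi
    rw [refl_apply_self, refl_apply_of_ne nc hij, refl_apply_of_ne nc hij, refl_apply_self,
      neighborSum_refl_of_not nc h]
  · rw [refl_apply_of_ne nc hi]
    by_cases hj : k = j
    · subst hj
      rw [refl_apply_self, refl_apply_self, neighborSum_refl_of_not nc h', refl_apply_of_ne nc hi]
    · rw [refl_apply_of_ne nc hj, refl_apply_of_ne nc hj, refl_apply_of_ne nc hi]

include hsymm in
/-- Along a reduced word, every coordinate of the all-ones vector stays positive, and a coordinate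
that is at least twice the sum of its neighbours belongs to a letter that was applied last, up to
commutations. -/
theorem act_one_pos (hnb : ∀ i, ∃ j, nc i j) {l : List V} (hl : Reduced nc l) :
    ∀ i, 0 < act nc l 1 i ∧ (¬ Desc nc l i → act nc l 1 i < 2 * neighborSum nc i (act nc l 1)) := by
  have sum_ge : ∀ (x : V → ℤ) (i j : V), (∀ k, 0 < x k) → nc i j → x j ≤ neighborSum nc i x := by
    intro x i j hx hij
    rw [neighborSum_apply]
    have := Finset.single_le_sum (f := fun j => if nc i j then x j else 0) (s := Finset.univ)
      (fun k _ => by split_ifs; exacts [(hx k).le, le_rfl]) (Finset.mem_univ j)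
    simpa [hij] using this
  induction l with
  | nil =>
    intro i
    obtain ⟨j, hj⟩ := hnb i
    have := sum_ge 1 i j (fun _ => by simp) hj
    simp only [act_nil, Module.End.one_apply, Pi.one_apply] at this ⊢
    exact ⟨by norm_num, fun _ => by linarith⟩
  | cons a l ih =>
    obtain ⟨ha, hl⟩ := hl
    specialize ih hl
    simp only [act_cons, Module.End.mul_apply]
    set x := act nc l 1 with hx
    have hxa := (ih a).2 ha
    have hpos : ∀ k, 0 < refl nc a x k := by
      intro k
      by_cases hk : k = a
      · subst hk
        rw [refl_apply_self]
        linarith [(ih k).1]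
      · rw [refl_apply_of_ne nc hk]; exact (ih k).1
    intro i
    refine ⟨hpos i, fun hi => ?_⟩
    have hia : i ≠ a := fun h => hi (Or.inl h)
    rw [refl_apply_of_ne nc hia]
    by_cases hn : nc i a
    · have h1 := sum_ge (refl nc a x) i a hpos hn
      rw [refl_apply_self] at h1
      have h2 := sum_ge x a i (fun k => (ih k).1) (hsymm _ _ hn)
      linarith [(ih i).1]
    · rw [neighborSum_refl_of_not nc hn]
      exact (ih i).2 fun h => hi (Or.inr ⟨hn, h⟩)

include hsymm in
/-- Each letter of a reduced word increases the sum of the coordinates, so a nonempty reduced word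
moves the all-ones vector. -/
theorem act_one_ne_one (hnb : ∀ i, ∃ j, nc i j) {l : List V} (hl : Reduced nc l) (hne : l ≠ []) :
    act nc l 1 ≠ 1 := by
  have step : ∀ (a : V) (l : List V), Reduced nc (a :: l) →
      ∑ i, act nc l 1 i < ∑ i, act nc (a :: l) 1 i := by
    intro a l h
    have hxa := (act_one_pos nc hsymm hnb h.2 a).2 h.1
    rw [act_cons, Module.End.mul_apply]
    refine Finset.sum_lt_sum (fun i _ => ?_) ⟨a, Finset.mem_univ a, ?_⟩
    · by_cases hi : i = a
      · subst hi; rw [refl_apply_self]; linarith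
      · rw [refl_apply_of_ne nc hi]
    · rw [refl_apply_self]; linarith
  have mono : ∀ l : List V, Reduced nc l → ∑ i, (1 : V → ℤ) i ≤ ∑ i, act nc l 1 i := by
    intro l
    induction l with
    | nil => intro _; simp
    | cons a l ih => intro h; exact (ih h.2).trans (step a l h).le
  cases l with
  | nil => exact absurd rfl hne
  | cons a l =>
    intro h
    have h1 := step a l hl
    rw [h] at h1
    exact absurd (mono l hl.2) (not_le.2 h1)

end Action

section Deletion

variable {V : Type} (nc : V → V → Prop)

/-- A letter that can be moved to the front of a word can be split off there, in every monoid
in which the commutations hold. -/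
theorem Desc.exists_split {l : List V} {a : V} (h : Desc nc l a) :
    ∃ l' : List V, l'.length + 1 = l.length ∧ l' ⊆ l ∧
      ∀ (N : Type) (_ : Monoid N) (f : V → N),
        (∀ i j, ¬ nc i j → f i * f j = f j * f i) →
        (l.map f).prod = f a * (l'.map f).prod := by
  induction l with
  | nil => exact h.elim
  | cons b l ih =>
    rcases h with rfl | ⟨hab, h⟩
    · exact ⟨l, rfl, List.subset_cons_self _ _, fun N _ f _ => by simp⟩
    · obtain ⟨l', h1, h2, h3⟩ := ih h
      refine ⟨b :: l', by simp [h1], List.cons_subset_cons _ h2, fun N _ f hf => ?_⟩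
      simp only [List.map_cons, List.prod_cons]
      rw [h3 N _ f hf, ← mul_assoc, ← mul_assoc, hf _ _ hab]

/-- Every word can be reduced; the reduced word has the same value in every monoid in which the
generators are involutions and the commutations hold. -/
theorem exists_reduced (l : List V) :
    ∃ r : List V, Reduced nc r ∧ r.length ≤ l.length ∧ r ⊆ l ∧
      ∀ (N : Type) (_ : Monoid N) (f : V → N), (∀ i, f i * f i = 1) →
        (∀ i j, ¬ nc i j → f i * f j = f j * f i) →
        (l.map f).prod = (r.map f).prod := by
  induction hn : l.length using Nat.strong_induction_on generalizing l with
  | _ n ih =>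
    cases l with
    | nil => exact ⟨[], trivial, by simp, List.Subset.refl _, fun _ _ _ _ _ => rfl⟩
    | cons a l =>
      rw [List.length_cons] at hn
      obtain ⟨r, hr, hlen, hrl, hv⟩ := ih l.length (by omega) l rfl
      by_cases h : Desc nc r a
      · obtain ⟨r', h1, h2, h3⟩ := h.exists_split
        obtain ⟨s, hs, hslen, hsr, hsv⟩ := ih r'.length (by omega) r' rfl
        refine ⟨s, hs, by omega, fun x hx => List.mem_cons_of_mem _ (hrl (h2 (hsr hx))),
          fun N _ f hf hc => ?_⟩
        rw [List.map_cons, List.prod_cons, hv N _ f hf hc, h3 N _ f hc, ← mul_assoc, hf, one_mul,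
          hsv N _ f hf hc]
      · refine ⟨a :: r, ⟨h, hr⟩, by simp; omega, List.cons_subset_cons _ hrl,
          fun N _ f hf hc => ?_⟩
        simp only [List.map_cons, List.prod_cons, hv N _ f hf hc]

end Deletion

section Faithful

variable {V : Type} [Fintype V] [DecidableEq V] (nc : V → V → Prop) [DecidableRel nc]
  (hsymm : ∀ i j, nc i j → nc j i) (hirr : ∀ i, ¬ nc i i) (hnb : ∀ i, ∃ j, nc i j)

include hsymm hirr hnb in
/-- A word that fixes the all-ones vector is trivial in the right-angled Coxeter group: it has value
`1` in every monoid in which the generators are involutions and the commutations hold. -/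
theorem prod_eq_one_of_act_one {l : List V} (h : act nc l 1 = 1) {N : Type} [Monoid N]
    (f : V → N) (hf : ∀ i, f i * f i = 1)
    (hc : ∀ i j, ¬ nc i j → f i * f j = f j * f i) : (l.map f).prod = 1 := by
  obtain ⟨r, hr, -, -, hv⟩ := exists_reduced nc l
  have hact : act nc l = act nc r :=
    hv _ _ (refl nc) (refl_mul_self nc hirr) fun i j => refl_comm nc hsymm
  have hr' : r = [] := by
    by_contra hne
    exact act_one_ne_one nc hsymm hnb hr hne (hact ▸ h)
  rw [hv N _ f hf hc, hr']
  rfl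

/-- Deleting the letters outside `p` from a trivial word gives a trivial word. -/
theorem act_filter_eq_one (hsymm : ∀ i j, nc i j → nc j i) (hirr : ∀ i, ¬ nc i i)
    (hnb : ∀ i, ∃ j, nc i j) (p : V → Bool) {l : List V} (h : act nc l 1 = 1) :
    act nc (l.filter p) = 1 := by
  have key := prod_eq_one_of_act_one nc hsymm hirr hnb h
    (fun v => if p v then refl nc v else 1)
    (fun i => by split_ifs; exacts [refl_mul_self nc hirr i, one_mul 1])
    (fun i j hij => by
      split_ifs
      exacts [refl_comm nc hsymm hij, by simp, by simp, rfl])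
  rw [← key]
  clear key h
  induction l with
  | nil => rfl
  | cons a l ih =>
    by_cases ha : p a <;> simp [ha, ih]

include hirr in
theorem act_mul_act_reverse (l : List V) : act nc l * act nc l.reverse = 1 := by
  induction l with
  | nil => rfl
  | cons a l ih =>
    rw [List.reverse_cons, act_append, act_cons, mul_assoc, ← mul_assoc (act nc l), ih, one_mul,
      act_cons, act_nil, mul_one, refl_mul_self nc hirr]

include hirr in
theorem act_reverse_mul_act (l : List V) : act nc l.reverse * act nc l = 1 := by
  simpa using act_mul_act_reverse nc hirr l.reverse

omit [Fintype V] [DecidableEq V] [DecidableRel nc] in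
/-- If distinct letters of the word never commute, then it is reduced as soon as adjacent letters
are distinct. -/
theorem reduced_of_isChain {l : List V} (hnc : ∀ i ∈ l, ∀ j ∈ l, i ≠ j → nc i j)
    (hl : l.IsChain (· ≠ ·)) : Reduced nc l := by
  induction l with
  | nil => trivial
  | cons a l ih =>
    refine ⟨?_, ih (fun i hi j hj => hnc i (by simp [hi]) j (by simp [hj])) hl.tail⟩
    cases l with
    | nil => exact id
    | cons b l =>
      rw [List.isChain_cons_cons] at hl
      rintro (h | ⟨h, -⟩)
      · exact hl.1 h
      · exact h (hnc a (by simp) b (by simp) hl.1)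

include hsymm in
/-- Words with commuting letters have commuting actions. -/
theorem act_comm {l l' : List V} (h : ∀ i ∈ l, ∀ j ∈ l', ¬ nc i j) :
    act nc l * act nc l' = act nc l' * act nc l := by
  refine Commute.list_prod_left _ _ fun x hx => Commute.list_prod_right _ _ fun y hy => ?_
  obtain ⟨i, hi, rfl⟩ := List.mem_map.1 hx
  obtain ⟨j, hj, rfl⟩ := List.mem_map.1 hy
  exact refl_comm nc hsymm (h i hi j hj)

end Faithful

end RightAngled

/-! ### Queue machines -/

/-- A queue machine with states `S` and queue letters `A`: in state `s` it removes the first letter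
`a` of the queue, appends the word `(M s a).2` at the end and goes to the state `(M s a).1`. It
halts when the queue is empty. -/
def QueueMachine (S A : Type) : Type := S → A → S × List A

namespace QueueMachine

variable {S A : Type} (M : QueueMachine S A)

/-- One step of a queue machine on a state and a queue. -/
def step : S × List A → Option (S × List A)
  | (_, []) => none
  | (s, a :: w) => some ((M s a).1, w ++ (M s a).2)

/-- The word that is appended altogether while the letters of a word are removed one by one. -/
def output : S → List A → List A
  | _, [] => []
  | s, a :: v => (M s a).2 ++ output (M s a).1 v

/-- Halting as a fixed-point property: the machine halts on the queue `w` if and only if some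
word `v` is both the word of all removed letters and the word of all letters that were ever in the
queue. If letters are removed before they were appended, the queue was empty before. -/
theorem eval_dom_iff (s : S) (w : List A) :
    (StateTransition.eval M.step (s, w)).Dom ↔ ∃ v, w ++ M.output s v = v := by
  constructor
  · intro h
    obtain ⟨c, hc⟩ := Part.dom_iff_mem.1 h
    obtain ⟨hr, hc⟩ := StateTransition.mem_eval.1 hc
    have : ∀ c', StateTransition.Reaches M.step c' c → ∃ v, c'.2 ++ M.output c'.1 v = v := by
      intro c' h
      induction h using Relation.ReflTransGen.head_induction_on with
      | refl =>
        obtain ⟨s, w⟩ := c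
        cases w with
        | nil => exact ⟨[], rfl⟩
        | cons a w => simp [step] at hc
      | head h1 _ ih =>
        rename_i c1 c2 _
        obtain ⟨s1, w1⟩ := c1
        obtain ⟨v, hv⟩ := ih
        cases w1 with
        | nil => simp [step] at h1
        | cons a w1 =>
          simp only [step, Option.mem_def, Option.some.injEq] at h1
          subst h1
          refine ⟨a :: v, ?_⟩
          simpa [output, List.append_assoc] using hv
    exact this _ hr
  · rintro ⟨v, hv⟩
    induction v generalizing s w with
    | nil =>
      obtain rfl : w = [] := (List.append_eq_nil_iff.1 hv).1
      exact Part.dom_iff_mem.2 ⟨(s, []), StateTransition.mem_eval.2 ⟨.refl, rfl⟩⟩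
    | cons a v ih =>
      cases w with
      | nil => exact Part.dom_iff_mem.2 ⟨(s, []), StateTransition.mem_eval.2 ⟨.refl, rfl⟩⟩
      | cons b w =>
        simp only [output, List.cons_append, List.cons.injEq] at hv
        obtain ⟨rfl, hv⟩ := hv
        rw [StateTransition.reaches_eval (f := M.step) (b := ((M s b).1, w ++ (M s b).2))
          (.single rfl)]
        exact ih _ _ (by rw [List.append_assoc]; exact hv)

/-- The nodes of the graph whose edges are the tiles: an initial node, the states of the
machine, a node for the comparison of the two tracks, and a final node. -/
inductive Node (S : Type) : Type
  | init
  | state (s : S)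
  | compare
  | final
  deriving DecidableEq, Fintype

/-- The generators of the right-angled Coxeter group: for each of the two tracks, one for every
queue letter and an additional one, and one for every node. -/
abbrev Gen (S A : Type) : Type := (Bool × Option A) ⊕ Node S

/-- The generator belongs to the track `i`. -/
def onTrack (i : Bool) : Gen S A → Bool
  | .inl (j, _) => j == i
  | .inr _ => false

/-- Distinct generators do not commute, unless they belong to different tracks. -/
def NC (u v : Gen S A) : Prop :=
  u ≠ v ∧ ∀ i, onTrack i u = true → onTrack (!i) v = false

instance [DecidableEq S] [DecidableEq A] : DecidableRel (NC (S := S) (A := A)) :=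
  fun u v => inferInstanceAs (Decidable (u ≠ v ∧ ∀ i, onTrack i u = true → onTrack (!i) v = false))

theorem NC.symm {u v : Gen S A} (h : NC u v) : NC v u := by
  refine ⟨h.1.symm, fun i hi => ?_⟩
  by_contra hc
  have := h.2 (!i) (by simpa using hc)
  simp [hi] at this

theorem NC.irrefl (u : Gen S A) : ¬ NC u u := fun h => h.1 rfl

theorem NC.exists_right (u : Gen S A) : ∃ v, NC u v := by
  rcases u with u | n
  · exact ⟨.inr .init, by simp [NC, onTrack]⟩
  · exact ⟨.inl (true, none), by simp [NC, onTrack]⟩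

theorem nc_node_left (n : Node S) {v : Gen S A} (h : .inr n ≠ v) : NC (.inr n) v :=
  ⟨h, by simp [onTrack]⟩

theorem nc_node_right (n : Node S) {v : Gen S A} (h : v ≠ .inr n) : NC v (.inr n) :=
  (nc_node_left n h.symm).symm

/-- The word of generators for a queue word on the track `i`: every queue letter becomes a product
of two generators, which has infinite order. -/
def enc (i : Bool) (w : List A) : List (Gen S A) :=
  w.flatMap fun a => [.inl (i, some a), .inl (i, none)]

@[simp] theorem enc_nil (i : Bool) : enc (S := S) (A := A) i [] = [] := rfl

@[simp] theorem enc_cons (i : Bool) (a : A) (w : List A) :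
    enc (S := S) i (a :: w) = .inl (i, some a) :: .inl (i, none) :: enc i w := rfl

@[simp] theorem enc_append (i : Bool) (w w' : List A) :
    enc (S := S) i (w ++ w') = enc i w ++ enc i w' := by
  simp [enc]

theorem onTrack_of_mem_enc {i : Bool} {w : List A} {u : Gen S A} (h : u ∈ enc i w) :
    onTrack i u = true := by
  simp only [enc, List.mem_flatMap] at h
  obtain ⟨a, -, h⟩ := h
  simp at h
  rcases h with rfl | rfl <;> simp [onTrack]

theorem filter_enc_self (i : Bool) (w : List A) :
    (enc (S := S) i w).filter (onTrack i) = enc i w :=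
  List.filter_eq_self.2 fun _ h => onTrack_of_mem_enc h

theorem filter_enc_of_ne {i j : Bool} (hij : i ≠ j) (w : List A) :
    (enc (S := S) j w).filter (onTrack i) = [] := by
  refine List.filter_eq_nil_iff.2 fun u h => ?_
  have := onTrack_of_mem_enc h
  rcases u with ⟨k, _⟩ | n
  · simp only [onTrack, beq_iff_eq] at this ⊢
    subst this
    exact fun h => hij h.symm
  · simp [onTrack]

theorem isChain_enc (i : Bool) (w : List A) : (enc (S := S) i w).IsChain (· ≠ ·) := by
  induction w with
  | nil => exact List.isChain_nil
  | cons a w ih =>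
    cases w with
    | nil => simp
    | cons b w =>
      simp only [enc_cons] at ih ⊢
      simpa using ih

theorem head?_enc (i : Bool) (w : List A) :
    (enc (S := S) i w).head? = w.head?.map fun a => .inl (i, some a) := by
  cases w <;> simp

section Faithful

variable [DecidableEq S] [Fintype S] [DecidableEq A] [Fintype A]

theorem enc_head?_eq {i : Bool} {v w : List A}
    (h : RightAngled.act (NC (S := S)) ((enc i v).reverse ++ enc i w) = 1) :
    v.head? = w.head? := by
  by_contra hne
  refine RightAngled.act_one_ne_one (NC (S := S)) (fun _ _ => NC.symm) NC.exists_right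
    (l := (enc i v).reverse ++ enc i w) ?_ ?_ (by rw [h]; rfl)
  · refine RightAngled.reduced_of_isChain _ ?_ ?_
    · intro u hu u' hu' huu'
      have track : ∀ u ∈ (enc (S := S) i v).reverse ++ enc i w, onTrack i u = true := by
        intro u hu
        rcases List.mem_append.1 hu with hu | hu
        · exact onTrack_of_mem_enc (List.mem_reverse.1 hu)
        · exact onTrack_of_mem_enc hu
      refine ⟨huu', fun j hj => ?_⟩
      have h1 := track u hu
      have h2 := track u' hu'
      rcases u with ⟨k, _⟩ | n <;> rcases u' with ⟨k', _⟩ | n' <;> simp_all [onTrack]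
    · refine List.isChain_append.2 ⟨List.isChain_reverse.2 ?_, isChain_enc i w, ?_⟩
      · exact (isChain_enc i v).imp fun _ _ h => h.symm
      · intro x hx y hy
        rw [List.getLast?_reverse, head?_enc] at hx
        rw [head?_enc] at hy
        rintro rfl
        clear h
        cases v <;> cases w <;> simp_all
        subst hy
        simp_all
  · cases v <;> cases w <;> simp_all

/-- The generators that encode the queue letters of one track generate a free monoid. -/
theorem eq_of_act_enc_eq {i : Bool} {v w : List A}
    (h : RightAngled.act (NC (S := S)) (enc i v) = RightAngled.act NC (enc i w)) : v = w := by
  have hrev := RightAngled.act_reverse_mul_act (NC (S := S) (A := A)) NC.irrefl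
  induction v generalizing w with
  | nil =>
    have := enc_head?_eq (S := S) (i := i) (v := []) (w := w) (by simp [← h])
    cases w
    · rfl
    · simp at this
  | cons a v ih =>
    have hh := enc_head?_eq (S := S) (i := i) (v := a :: v) (w := w)
      (by rw [RightAngled.act_append, ← h, hrev])
    cases w with
    | nil => simp at hh
    | cons b w =>
      obtain rfl : a = b := by simpa using hh
      rw [ih (w := w)]
      have key : ∀ x : List A, RightAngled.act (NC (S := S)) (enc i x) =
          RightAngled.act NC (enc i [a]).reverse * RightAngled.act NC (enc i (a :: x)) := by
        intro x
        rw [show a :: x = [a] ++ x from rfl, enc_append i [a], RightAngled.act_append, ← mul_assoc,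
          hrev, one_mul]
      rw [key v, key w, h]

end Faithful

end QueueMachine

/-! ### Products of tiles -/

namespace QueueMachine

/-- The tiles of a queue machine. Read one after the other along a path from `Node.init` to
`Node.final` in the graph of nodes, they start the machine, let it make some steps, stop it, and
compare the word of all letters that were ever in the queue with the word of all removed letters
by removing the same letters from the ends of both. -/
inductive Tile (S A : Type) : Type
  | start
  | step (s : S) (a : A)
  | switch (s : S)
  | pop (a : A)
  | close
  deriving Fintype

namespace Tile

variable {S A : Type} (M : QueueMachine S A) (s₀ : S) (w₀ : List A)

/-- The node at which a tile starts. -/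
def src : Tile S A → Node S
  | start => .init
  | step s _ => .state s
  | switch s => .state s
  | pop _ => .compare
  | close => .compare

/-- The node at which a tile ends. -/
def tgt : Tile S A → Node S
  | start => .state s₀
  | step s a => .state (M s a).1
  | switch _ => .compare
  | pop _ => .compare
  | close => .final

/-- What a tile contributes to the tracks: the appended letters on the track `true`, the removed
letters on the track `false`. -/
def body : Tile S A → List (Gen S A)
  | start => enc true w₀
  | step s a => enc true (M s a).2 ++ enc false [a]
  | switch _ => []
  | pop a => (enc true [a]).reverse ++ (enc false [a]).reverse
  | close => []

/-- The generator of the node, except for the initial node, which has none. -/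
def lead : Node S → List (Gen S A)
  | .init => []
  | n => [.inr n]

/-- The word of generators of a tile: its body between the generators of its nodes. The generator
of the initial node is left out, so that a path from `Node.init` to `Node.final` with trivial body
multiplies to a single generator, which is an involution. -/
def word (t : Tile S A) : List (Gen S A) :=
  lead t.src ++ t.body M w₀ ++ [.inr (t.tgt M s₀)]

/-- `IsPath M s₀ x l y`: the tiles in `l` form a path from `x` to `y`. -/
def IsPath : Node S → List (Tile S A) → Node S → Prop
  | x, [], y => x = y
  | x, t :: l, y => t.src = x ∧ IsPath (t.tgt M s₀) l y

variable {M s₀ w₀}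

theorem tgt_ne_init (t : Tile S A) : t.tgt M s₀ ≠ .init := by cases t <;> simp [tgt]

theorem src_ne_final (t : Tile S A) : t.src ≠ .final := by cases t <;> simp [src]

theorem lead_of_ne {n : Node S} (h : n ≠ .init) : lead (A := A) n = [.inr n] := by
  cases n <;> simp_all [lead]

theorem isPath_append {x y z : Node S} {l l' : List (Tile S A)} (h : IsPath M s₀ x l y)
    (h' : IsPath M s₀ y l' z) : IsPath M s₀ x (l ++ l') z := by
  induction l generalizing x with
  | nil => obtain rfl : x = y := h; exact h'
  | cons t l ih => exact ⟨h.1, ih h.2⟩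

/-- On a path that starts at `Node.compare` only tiles `pop` occur, and at most one `close`. -/
theorem filter_of_isPath_compare {l : List (Tile S A)} {y : Node S}
    (h : IsPath M s₀ .compare l y) :
    ∃ u : List A, (∀ i, (l.flatMap (body M w₀)).filter (onTrack i) = (enc i u).reverse) ∧
      (y = .compare → u.length = l.length) := by
  induction l with
  | nil => exact ⟨[], by simp, by simp⟩
  | cons t l ih =>
    obtain ⟨ht, h⟩ := h
    cases t with
    | pop a =>
      obtain ⟨u, hu, hlen⟩ := ih h
      refine ⟨u ++ [a], fun i => ?_, fun hy => by simp [hlen hy]⟩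
      simp only [List.flatMap_cons, body, List.filter_append, hu, List.filter_reverse, enc_append,
        List.reverse_append]
      cases i
      · rw [filter_enc_self, filter_enc_of_ne (by simp)]; simp
      · rw [filter_enc_self, filter_enc_of_ne (by simp)]; simp
    | close =>
      cases l with
      | nil =>
        obtain rfl : Node.final = y := h
        exact ⟨[], by simp [body], by simp⟩
      | cons t' l => exact absurd h.1 (src_ne_final t')
    | _ => simp [src] at ht

/-- A path that starts at a state of the machine consists of some steps, during which the word `v`
is removed, and possibly of a comparison. -/
theorem filter_of_isPath_state {l : List (Tile S A)} {s : S} {y : Node S}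
    (h : IsPath M s₀ (.state s) l y) :
    ∃ v u : List A,
      (l.flatMap (body M w₀)).filter (onTrack true) =
        enc true (M.output s v) ++ (enc true u).reverse ∧
      (l.flatMap (body M w₀)).filter (onTrack false) = enc false v ++ (enc false u).reverse ∧
      (∀ s', y = .state s' → u = [] ∧ v.length = l.length) := by
  induction l generalizing s with
  | nil => exact ⟨[], [], by simp [output], by simp, by simp⟩
  | cons t l ih =>
    obtain ⟨ht, h⟩ := h
    cases t with
    | step s' a =>
      obtain rfl : s' = s := by simpa [src] using ht
      obtain ⟨v, u, h1, h2, h3⟩ := ih h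
      refine ⟨a :: v, u, ?_, ?_, fun s'' hs => ⟨(h3 s'' hs).1, by simp [(h3 s'' hs).2]⟩⟩
      · simp only [List.flatMap_cons, body, List.filter_append, h1, filter_enc_self,
          filter_enc_of_ne (show true ≠ false by simp), output, enc_append, List.nil_append,
          List.append_assoc]
      · simp only [List.flatMap_cons, body, List.filter_append, h2, filter_enc_self,
          filter_enc_of_ne (show false ≠ true by simp), List.nil_append]
        rfl
    | switch s' =>
      obtain ⟨u, hu, -⟩ := filter_of_isPath_compare (w₀ := w₀)
        (show IsPath M s₀ .compare l y from h)
      refine ⟨[], u, by simpa [body, output] using hu true, by simpa [body] using hu false, ?_⟩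
      rintro s'' rfl
      exfalso
      clear ih hu
      change IsPath M s₀ .compare l (.state s'') at h
      induction l with
      | nil => simp [IsPath] at h
      | cons t l ih =>
        obtain ⟨ht', h⟩ := h
        cases t with
        | pop a => exact ih h
        | close =>
          cases l with
          | nil => simp [IsPath, tgt] at h
          | cons t' l => exact src_ne_final t' h.1
        | _ => simp [src] at ht'
    | _ => simp [src] at ht

section Group

variable [DecidableEq S] [Fintype S] [DecidableEq A] [Fintype A]

open RightAngled

theorem act_words_of_isPath {l : List (Tile S A)} {x y : Node S} (h : IsPath M s₀ x l y)
    (hne : l ≠ []) : act NC (l.flatMap (word M s₀ w₀)) =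
      act NC (lead x ++ l.flatMap (body M w₀) ++ [.inr y]) := by
  induction l generalizing x with
  | nil => exact absurd rfl hne
  | cons t l ih =>
    obtain ⟨rfl, h⟩ := h
    cases l with
    | nil =>
      obtain rfl : t.tgt M s₀ = y := h
      simp [word]
    | cons t' l =>
      rw [List.flatMap_cons, act_append, ih h (by simp), word, lead_of_ne (tgt_ne_init t),
        List.flatMap_cons (x := t)]
      simp only [act_append, act_cons, act_nil, mul_one, mul_assoc]
      rw [← mul_assoc (refl NC (.inr (t.tgt M s₀))), refl_mul_self NC NC.irrefl, one_mul]

/-- A path with trivial body does not start at the initial node if the machine does not halt, and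
is never closed. -/
theorem not_trivial_of_isPath (hno : ∀ v, w₀ ++ M.output s₀ v ≠ v)
    {l : List (Tile S A)} {x y : Node S} (h : IsPath M s₀ x l y) (hne : l ≠ [])
    (hact : act NC (l.flatMap (body M w₀)) = 1) : x ≠ .init ∧ x ≠ y := by
  have filt : ∀ i, act NC ((l.flatMap (body M w₀)).filter (onTrack i)) = 1 := fun i =>
    act_filter_eq_one NC (fun _ _ => NC.symm) NC.irrefl NC.exists_right _ (by rw [hact]; rfl)
  have cancel : ∀ (i : Bool) (v u : List A),
      act (NC (S := S)) (enc i v ++ (enc i u).reverse) = 1 → v = u := by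
    intro i v u h
    refine eq_of_act_enc_eq (S := S) (i := i) ?_
    rw [act_append] at h
    rw [← mul_one (act NC (enc i v)), ← act_reverse_mul_act NC NC.irrefl (enc i u), ← mul_assoc, h,
      one_mul]
  have hlen : 0 < l.length := List.length_pos_of_ne_nil hne
  cases x with
  | init =>
    exfalso
    cases l with
    | nil => exact hne rfl
    | cons t l =>
      obtain ⟨ht, h⟩ := h
      cases t with
      | start =>
        obtain ⟨v, u, h1, h2, -⟩ := filter_of_isPath_state (w₀ := w₀) h
        have f1 := filt true
        have f2 := filt false
        rw [List.flatMap_cons, List.filter_append, h1, body, filter_enc_self, ← List.append_assoc,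
          ← enc_append] at f1
        rw [List.flatMap_cons, List.filter_append, h2, body, filter_enc_of_ne (by simp),
          List.nil_append] at f2
        exact hno v ((cancel _ _ _ f1).trans (cancel _ _ _ f2).symm)
      | _ => simp [src] at ht
  | state s =>
    refine ⟨by simp, ?_⟩
    rintro rfl
    obtain ⟨v, u, -, h2, h3⟩ := filter_of_isPath_state (w₀ := w₀) h
    obtain ⟨rfl, hv⟩ := h3 s rfl
    have f2 := filt false
    rw [h2] at f2
    have := cancel _ _ _ f2
    subst this
    simp at hv
    omega
  | compare =>
    refine ⟨by simp, ?_⟩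
    rintro rfl
    obtain ⟨u, h1, h2⟩ := filter_of_isPath_compare (w₀ := w₀) h
    have f1 := filt true
    rw [h1] at f1
    have := cancel true [] u (by simpa using f1)
    subst this
    have := h2 rfl
    simp at this
    omega
  | final =>
    cases l with
    | nil => exact absurd rfl hne
    | cons t l => exact absurd h.1 (src_ne_final t)

omit [DecidableEq S] [Fintype S] [DecidableEq A] [Fintype A] in
theorem track_of_mem_body {t : Tile S A} {u : Gen S A} (h : u ∈ t.body M w₀) :
    ∃ p, u = .inl p := by
  have key : ∀ (i : Bool) (v : List A), u ∈ enc i v → ∃ p, u = .inl p := by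
    intro i v hu
    have := onTrack_of_mem_enc hu
    rcases u with p | n
    · exact ⟨p, rfl⟩
    · simp [onTrack] at this
  cases t <;> simp only [body, List.mem_append, List.mem_reverse, List.not_mem_nil] at h
  · exact key _ _ h
  · exact h.elim (key _ _) (key _ _)
  · exact h.elim (key _ _) (key _ _)

omit [DecidableEq S] [Fintype S] [DecidableEq A] [Fintype A] in
/-- A reduced track word in front of a reduced word that starts with a node generator is reduced
with it. -/
theorem reduced_append_node {k r : List (Gen S A)} {n : Node S} (hk : ∀ u ∈ k, ∃ p, u = .inl p)
    (hkr : Reduced NC k) (hr : Reduced NC (.inr n :: r)) : Reduced NC (k ++ .inr n :: r) := by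
  have desc : ∀ (k : List (Gen S A)) (p : Bool × Option A),
      Desc NC (k ++ .inr n :: r) (.inl p) → Desc NC k (.inl p) := by
    intro k p
    induction k with
    | nil =>
      rintro (h | ⟨h, -⟩)
      · simp at h
      · exact absurd (nc_node_right n (by simp)) h
    | cons a k ih =>
      rintro (h | ⟨h, h'⟩)
      · exact Or.inl h
      · exact Or.inr ⟨h, ih h'⟩
  induction k with
  | nil => exact hr
  | cons a k ih =>
    obtain ⟨p, rfl⟩ := hk a (by simp)
    exact ⟨fun h => hkr.1 (desc k p h), ih (fun u hu => hk u (by simp [hu])) hkr.2⟩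

omit [DecidableEq S] [Fintype S] [DecidableEq A] [Fintype A] in
theorem reduced_node_cons {l : List (Gen S A)} {n : Node S} (hl : Reduced NC l)
    (h : l.head? ≠ some (.inr n)) : Reduced NC (.inr n :: l) := by
  refine ⟨?_, hl⟩
  cases l with
  | nil => exact id
  | cons a l =>
    rintro (h' | ⟨h', -⟩)
    · exact h (by simp [h'])
    · exact h' (nc_node_left n fun h'' => h (by simp [h'']))

/-- If the machine does not halt, then every nonempty product of tiles has a reduced word that
starts with the body of a path. -/
theorem exists_reduced_words (hno : ∀ v, w₀ ++ M.output s₀ v ≠ v) {ts : List (Tile S A)}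
    (hne : ts ≠ []) : ∃ (x y : Node S) (l : List (Tile S A)) (k r : List (Gen S A)),
      IsPath M s₀ x l y ∧ l ≠ [] ∧ (∀ u ∈ k, ∃ p, u = .inl p) ∧
      act NC k = act NC (l.flatMap (body M w₀)) ∧ Reduced NC (lead x ++ k ++ .inr y :: r) ∧
      act NC (ts.flatMap (word M s₀ w₀)) = act NC (lead x ++ k ++ .inr y :: r) := by
  -- a path and a reduced word for what follows its last node
  have build : ∀ (x y : Node S) (l : List (Tile S A)) (r : List (Gen S A)),
      IsPath M s₀ x l y → l ≠ [] → Reduced NC (.inr y :: r) →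
      ∃ k : List (Gen S A), (∀ u ∈ k, ∃ p, u = .inl p) ∧ (x = .init → k ≠ []) ∧
        act NC k = act NC (l.flatMap (body M w₀)) ∧ Reduced NC (lead x ++ k ++ .inr y :: r) := by
    intro x y l r hl hne hr
    obtain ⟨k, hk, -, hsub, hv⟩ := exists_reduced NC (l.flatMap (body M w₀))
    have hkl : ∀ u ∈ k, ∃ p, u = .inl p := by
      intro u hu
      obtain ⟨t, -, ht⟩ := List.mem_flatMap.1 (hsub hu)
      exact track_of_mem_body ht
    have hact : act NC k = act NC (l.flatMap (body M w₀)) :=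
      (hv _ _ (refl NC) (refl_mul_self NC NC.irrefl)
        fun i j => refl_comm NC (fun _ _ => NC.symm)).symm
    have hnt : k = [] → x ≠ .init ∧ x ≠ y := fun h =>
      not_trivial_of_isPath hno hl hne (by rw [← hact, h]; rfl)
    have hkr := reduced_append_node hkl hk hr
    refine ⟨k, hkl, fun hx h => (hnt h).1 hx, hact, ?_⟩
    by_cases hx : x = .init
    · subst hx
      exact hkr
    · rw [lead_of_ne hx]
      refine reduced_node_cons hkr ?_
      cases k with
      | nil => simpa using fun h => (hnt rfl).2 h.symm
      | cons a k =>
        obtain ⟨p, rfl⟩ := hkl a (by simp)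
        simp
  induction ts with
  | nil => exact absurd rfl hne
  | cons t ts ih =>
    have ht : IsPath M s₀ t.src [t] (t.tgt M s₀) := ⟨rfl, rfl⟩
    by_cases hts : ts = []
    · subst hts
      obtain ⟨k, h1, -, h2, h3⟩ := build _ _ [t] [] ht (by simp) ⟨id, trivial⟩
      refine ⟨_, _, [t], k, [], ht, by simp, h1, h2, h3, ?_⟩
      simp only [List.flatMap_cons, List.flatMap_nil, List.append_nil] at h2 ⊢
      simp only [word, act_append, h2]
    · obtain ⟨x, y, l, k, r, hl, hlne, hk, hact, hred, hw⟩ := ih hts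
      by_cases hx : t.tgt M s₀ = x
      -- the tile extends the path: the node between them cancels, the track parts multiply
      · have hpath : IsPath M s₀ t.src (t :: l) y := ⟨rfl, by rw [hx]; exact hl⟩
        have hr : Reduced NC (.inr y :: r) := by
          have suffix : ∀ l l' : List (Gen S A), Reduced NC (l ++ l') → Reduced NC l' := by
            intro l l' h
            induction l with
            | nil => exact h
            | cons a l ih => exact ih h.2
          exact suffix _ _ hred
        obtain ⟨k', h1, -, h2, h3⟩ := build _ _ (t :: l) r hpath (by simp) hr
        refine ⟨_, _, t :: l, k', r, hpath, by simp, h1, h2, h3, ?_⟩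
        rw [List.flatMap_cons, act_append, hw, word, lead_of_ne (n := x) (hx ▸ tgt_ne_init t), hx]
        simp only [act_append, act_cons, act_nil, mul_one, mul_assoc, h2, hact, List.flatMap_cons]
        rw [← mul_assoc (refl NC (.inr x)), refl_mul_self NC NC.irrefl, one_mul]
      -- the tile does not fit: nothing cancels, and it forms a new path
      · have hxk : x = .init → k ≠ [] := by
          rintro rfl rfl
          exact (not_trivial_of_isPath hno hl hlne (by rw [← hact]; rfl)).1 rfl
        obtain ⟨k', h1, -, h2, h3⟩ := build _ _ [t] (lead x ++ k ++ .inr y :: r) ht (by simp) <| by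
          refine reduced_node_cons hred ?_
          by_cases hi : x = .init
          · subst hi
            cases k with
            | nil => exact absurd rfl (hxk rfl)
            | cons a k =>
              obtain ⟨p, rfl⟩ := hk a (by simp)
              simp [lead]
          · rw [lead_of_ne hi]
            simpa using fun h => hx h.symm
        refine ⟨_, _, [t], k', _, ht, by simp, h1, h2, h3, ?_⟩
        rw [List.flatMap_cons, act_append, hw, word]
        simp only [List.flatMap_cons, List.flatMap_nil, List.append_nil] at h2
        simp only [act_append, act_cons, act_nil, mul_one, mul_assoc, h2]

/-- If some nonempty product of tiles fixes the all-ones vector, the machine halts. -/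
theorem halts_of_act_words {ts : List (Tile S A)} (hne : ts ≠ [])
    (h : act NC (ts.flatMap (word M s₀ w₀)) 1 = 1) : ∃ v, w₀ ++ M.output s₀ v = v := by
  by_contra! hno
  obtain ⟨x, y, l, k, r, -, -, -, -, hred, hw⟩ := exists_reduced_words hno hne
  exact act_one_ne_one NC (fun _ _ => NC.symm) NC.exists_right hred (by simp) (hw ▸ h)

omit [DecidableEq S] [Fintype S] [DecidableEq A] [Fintype A] in
theorem not_nc_enc {v v' : List A} {a b : Gen S A} (ha : a ∈ enc true v) (hb : b ∈ enc false v') :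
    ¬ NC b a := by
  intro h
  have := h.2 false (onTrack_of_mem_enc hb)
  rw [Bool.not_false, onTrack_of_mem_enc ha] at this
  simp at this

theorem enc_comm (v v' : List A) :
    act (NC (S := S)) (enc false v) * act NC (enc true v') =
      act NC (enc true v') * act NC (enc false v) :=
  act_comm NC (fun _ _ => NC.symm) fun _ hi _ hj => not_nc_enc hj hi

theorem enc_comm_reverse (v v' : List A) :
    act (NC (S := S)) (enc true v).reverse * act NC (enc false v').reverse =
      act NC (enc false v').reverse * act NC (enc true v).reverse :=
  act_comm NC (fun _ _ => NC.symm) fun _ hi _ hj h =>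
    not_nc_enc (List.mem_reverse.1 hi) (List.mem_reverse.1 hj) h.symm

/-- If the machine halts, some nonempty product of tiles is trivial: the tiles of a complete path
multiply to the generator of the final node, which is an involution. -/
theorem exists_act_words_eq_one {v : List A} (h : w₀ ++ M.output s₀ v = v) :
    ∃ ts : List (Tile S A), ts ≠ [] ∧ act NC (ts.flatMap (word M s₀ w₀)) = 1 := by
  have steps : ∀ (v : List A) (s : S), ∃ (l : List (Tile S A)) (s' : S),
      IsPath M s₀ (.state s) l (.state s') ∧
      act NC (l.flatMap (body M w₀)) =
        act NC (enc true (M.output s v)) * act NC (enc false v) := by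
    intro v
    induction v with
    | nil => exact fun s => ⟨[], s, rfl, by simp [output]⟩
    | cons a v ih =>
      intro s
      obtain ⟨l, s', hl, hact⟩ := ih (M s a).1
      refine ⟨step s a :: l, s', ⟨rfl, hl⟩, ?_⟩
      rw [List.flatMap_cons, act_append, hact, body, output, enc_append,
        show enc false (a :: v) = enc false [a] ++ enc false v from rfl]
      simp only [act_append, mul_assoc]
      rw [← mul_assoc (act NC (enc false [a])), enc_comm, mul_assoc]
  have pops : ∀ v : List A, IsPath M s₀ .compare (v.reverse.map pop) .compare ∧
      act NC ((v.reverse.map pop).flatMap (body M w₀)) =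
        act NC (enc false v).reverse * act NC (enc true v).reverse := by
    intro v
    induction v with
    | nil => exact ⟨rfl, by simp⟩
    | cons a v ih =>
      rw [List.reverse_cons, List.map_append]
      refine ⟨isPath_append ih.1 ⟨rfl, rfl⟩, ?_⟩
      rw [List.flatMap_append, act_append, ih.2,
        show enc false (a :: v) = enc false [a] ++ enc false v from rfl,
        show enc true (a :: v) = enc true [a] ++ enc true v from rfl]
      simp only [List.map_cons, List.map_nil, List.flatMap_cons, List.flatMap_nil, List.append_nil,
        body, List.reverse_append, act_append, mul_assoc]
      rw [enc_comm_reverse [a] [a], ← mul_assoc (act NC (enc true v).reverse), enc_comm_reverse,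
        mul_assoc]
  obtain ⟨l, s', hl, hact⟩ := steps v s₀
  obtain ⟨hp, hpact⟩ := pops v
  set ts : List (Tile S A) := start :: (l ++ switch s' :: (v.reverse.map pop ++ [close])) with hts
  have hpath : IsPath M s₀ .init ts .final :=
    ⟨rfl, isPath_append hl ⟨rfl, isPath_append hp ⟨rfl, rfl⟩⟩⟩
  have hval : act NC (ts.flatMap (word M s₀ w₀)) = refl NC (.inr .final) := by
    rw [act_words_of_isPath hpath (by simp [hts]), hts]
    simp only [lead, List.flatMap_cons, List.flatMap_append, List.flatMap_nil, body, act_append,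
      hact, hpact, List.nil_append, List.append_nil, act_cons, act_nil, mul_one]
    have h1 : act (NC (S := S)) (enc true w₀) * act NC (enc true (M.output s₀ v)) =
        act NC (enc true v) := by
      rw [← act_append, ← enc_append, h]
    simp only [← mul_assoc]
    rw [h1, mul_assoc (act NC (enc true v)), act_mul_act_reverse NC NC.irrefl, mul_one,
      act_mul_act_reverse NC NC.irrefl, one_mul]
  refine ⟨ts ++ ts, by simp [hts], ?_⟩
  rw [List.flatMap_append, act_append, hval, refl_mul_self NC NC.irrefl]

end Group

end Tile

end QueueMachine

/-! ### Simulation of stack machines by queue machines -/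

namespace QueueMachine

variable {K Γ Λ σ : Type} [DecidableEq K] [DecidableEq Γ]

open Turing Turing.TM2

/-- The contents of some stacks in one word: for each stack a separator, followed by its letters
from the top to the bottom. -/
def contents (ks : List K) (T : K → List Γ) : List (K ⊕ Γ) :=
  ks.flatMap fun k => .inl k :: (T k).map .inr

/-- A queue machine that simulates a machine with several stacks. Its queue is any rotation of the
word `contents`. A state consists of a statement, the values of the variables and a flag, which
is raised when the separator of the stack in question has just been read, so that the next letter
is the top of this stack, or a separator if this stack is empty. The statement `halt` empties the
queue. -/
def ofTM2 (M : Λ → Stmt (fun _ : K => Γ) Λ σ) :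
    QueueMachine (Bool × Stmt (fun _ : K => Γ) Λ σ × σ) (K ⊕ Γ)
  | (_, .push k f q, v), x =>
    if x = .inl k then ((false, q, v), [x, .inr (f v)]) else ((false, .push k f q, v), [x])
  | (false, .peek k f q, v), x => ((decide (x = .inl k), .peek k f q, v), [x])
  | (true, .peek _ f q, v), x => ((false, q, f v x.getRight?), [x])
  | (false, .pop k f q, v), x => ((decide (x = .inl k), .pop k f q, v), [x])
  | (true, .pop _ f q, v), x => ((false, q, f v x.getRight?), if x.isLeft then [x] else [])
  | (_, .load f q, v), x => ((false, q, f v), [x])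
  | (_, .branch f q₁ q₂, v), x => ((false, cond (f v) q₁ q₂, v), [x])
  | (_, .goto l, v), x => ((false, M (l v), v), [x])
  | (_, .halt, v), _ => ((false, .halt, v), [])

omit [DecidableEq K] [DecidableEq Γ] in
theorem reaches_rotate {S A : Type} (M : QueueMachine S A) {s : S} (a b : List A)
    (h : ∀ x ∈ a, M s x = (s, [x])) : StateTransition.Reaches M.step (s, a ++ b) (s, b ++ a) := by
  induction a generalizing b with
  | nil => rw [List.append_nil]; exact .refl
  | cons x a ih =>
    refine .head (b := (s, a ++ (b ++ [x]))) ?_ ?_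
    · simp [step, h x (by simp)]
    · have := ih (b ++ [x]) fun y hy => h y (by simp [hy])
      rwa [List.append_assoc, List.singleton_append] at this

omit [DecidableEq K] [DecidableEq Γ] in
/-- A state that moves all letters but `x` to the end brings `x` to the front. -/
theorem reaches_of_isRotated {S A : Type} (M : QueueMachine S A) {s : S} {x : A} {w t : List A}
    (h : ∀ y, y ≠ x → M s y = (s, [y])) (hw : w ~r x :: t) (ht : x ∉ t) :
    StateTransition.Reaches M.step (s, w) (s, x :: t) := by
  obtain ⟨n, hn, hr⟩ := List.isRotated_iff_mod.1 hw
  rw [List.rotate_eq_drop_append_take hn] at hr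
  cases hd : w.drop n with
  | nil =>
    have hw' := List.take_append_drop n w
    rw [hd, List.append_nil] at hw'
    rw [hd, List.nil_append, hw'] at hr
    rw [hr]
    exact .refl
  | cons y b =>
    rw [hd, List.cons_append, List.cons.injEq] at hr
    obtain ⟨rfl, hr⟩ := hr
    have hmem : ∀ z ∈ w.take n, M s z = (s, [z]) := fun z hz =>
      h z fun hzx => ht (hr ▸ List.mem_append_right _ (hzx ▸ hz))
    have := reaches_rotate M (w.take n) (w.drop n) hmem
    rwa [List.take_append_drop, hd, List.cons_append, hr] at this

omit [DecidableEq K] [DecidableEq Γ] in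
/-- A rotation brings any of the stacks to the front. -/
theorem exists_contents_isRotated {ks : List K} (hnd : ks.Nodup) {k : K} (hk : k ∈ ks) :
    ∃ ks' : List K, k ∉ ks' ∧ ∀ T : K → List Γ, contents ks T ~r contents (k :: ks') T := by
  obtain ⟨l₁, l₂, rfl⟩ := List.append_of_mem hk
  refine ⟨l₂ ++ l₁, ?_, fun T => ?_⟩
  · have := (List.nodup_middle.1 hnd)
    rw [List.nodup_cons] at this
    simp only [List.mem_append] at this ⊢
    tauto
  · have : contents (l₁ ++ k :: l₂) T = contents l₁ T ++ contents (k :: l₂) T := by simp [contents]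
    rw [this]
    refine List.isRotated_append.trans ?_
    rw [show contents (k :: l₂) T ++ contents l₁ T = contents (k :: (l₂ ++ l₁)) T by
      simp [contents]]

omit [DecidableEq Γ] in
theorem contents_update {ks : List K} {k : K} (hk : k ∉ ks) (T : K → List Γ) (l : List Γ) :
    contents ks (Function.update T k l) = contents ks T := by
  induction ks with
  | nil => rfl
  | cons k' ks ih =>
    simp only [List.mem_cons, not_or] at hk
    have := ih hk.2
    simp only [contents, List.flatMap_cons] at this ⊢
    rw [this, Function.update_of_ne (Ne.symm hk.1)]

omit [DecidableEq K] [DecidableEq Γ] in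
theorem contents_cons (k : K) (ks : List K) (T : K → List Γ) :
    contents (k :: ks) T = .inl k :: ((T k).map .inr ++ contents ks T) := rfl

omit [DecidableEq K] [DecidableEq Γ] in
theorem inl_not_mem {ks : List K} {k : K} (hk : k ∉ ks) (T : K → List Γ) (l : List Γ) :
    .inl k ∉ l.map .inr ++ contents ks T := by
  simp [contents, hk]

/-- The configurations of the queue machine that correspond to a configuration of the stack
machine. -/
def Represents (M : Λ → Stmt (fun _ : K => Γ) Λ σ) (ks : List K) :
    Cfg (fun _ : K => Γ) Λ σ → (Bool × Stmt (fun _ : K => Γ) Λ σ × σ) × List (K ⊕ Γ) → Prop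
  | ⟨some l, v, T⟩, c => c.1 = (false, M l, v) ∧ c.2 ~r contents ks T
  | ⟨none, _, _⟩, c => c.2 = []

/-- The queue machine executes a statement of the stack machine. -/
theorem exists_represents_stepAux (M : Λ → Stmt (fun _ : K => Γ) Λ σ) {ks : List K}
    (hnd : ks.Nodup) (hks : ∀ k, k ∈ ks) (k₀ : K) (q : Stmt (fun _ : K => Γ) Λ σ) (v : σ)
    (T : K → List Γ) (w : List (K ⊕ Γ)) (hw : w ~r contents ks T) :
    ∃ c, Represents M ks (stepAux q v T) c ∧
      StateTransition.Reaches₁ (ofTM2 M).step ((false, q, v), w) c := by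
  have hne : ∀ T : K → List Γ, ∀ w : List (K ⊕ Γ), w ~r contents ks T → w ≠ [] := by
    rintro T w hw rfl
    have := List.isRotated_nil_iff'.1 hw
    simp only [contents, List.nil_eq, List.flatMap_eq_nil_iff] at this
    simpa using this k₀ (hks k₀)
  -- statements that do not touch the stacks rotate the queue by one letter
  have turn : ∀ (q q' : Stmt (fun _ : K => Γ) Λ σ) (v v' : σ) (T : K → List Γ) (w : List (K ⊕ Γ)),
      w ~r contents ks T → (∀ x, ofTM2 M (false, q, v) x = ((false, q', v'), [x])) →
      ∃ w', w' ~r contents ks T ∧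
        ((false, q', v'), w') ∈ (ofTM2 M).step ((false, q, v), w) := by
    intro q q' v v' T w hw h
    cases w with
    | nil => exact absurd rfl (hne T _ hw)
    | cons x w =>
      refine ⟨w ++ [x], ?_, by simp [step, h]⟩
      exact (List.isRotated_append (l := w) (l' := [x])).trans hw
  -- behind the separator of a stack comes its top, or a separator
  have top : ∀ (T : K → List Γ) (ks' : List K) (k : K), ∃ (x : K ⊕ Γ) (t : List (K ⊕ Γ)),
      ((T k).map .inr ++ contents ks' T) ++ [.inl k] = x :: t ∧ x.getRight? = (T k).head? := by
    intro T ks' k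
    cases hT : T k with
    | cons a r => exact ⟨.inr a, _, rfl, rfl⟩
    | nil =>
      cases ks' with
      | nil => exact ⟨.inl k, _, rfl, rfl⟩
      | cons k' ks' => exact ⟨.inl k', _, rfl, rfl⟩
  induction q generalizing v T w with
  | push k f q ih =>
    obtain ⟨ks', hk', hrot⟩ := exists_contents_isRotated (Γ := Γ) hnd (hks k)
    have h1 := reaches_of_isRotated (ofTM2 M) (s := (false, .push k f q, v)) (x := .inl k)
      (t := (T k).map Sum.inr ++ contents ks' T)
      (fun y hy => by simp [ofTM2, hy]) (hw.trans (contents_cons k ks' T ▸ hrot T))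
      (inl_not_mem hk' T _)
    obtain ⟨c, hc, h2⟩ := ih v (Function.update T k (f v :: T k))
      (((T k).map .inr ++ contents ks' T) ++ [.inl k, .inr (f v)]) <| by
        refine List.IsRotated.trans ?_ (hrot _).symm
        rw [contents_cons, contents_update hk', Function.update_self]
        exact List.isRotated_append
    exact ⟨c, hc, (Relation.TransGen.tail' h1 (by simp [step, ofTM2])).trans h2⟩
  | peek k f q ih =>
    obtain ⟨ks', hk', hrot⟩ := exists_contents_isRotated (Γ := Γ) hnd (hks k)
    have h1 := reaches_of_isRotated (ofTM2 M) (s := (false, .peek k f q, v)) (x := .inl k)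
      (t := (T k).map Sum.inr ++ contents ks' T)
      (fun y hy => by simp [ofTM2, hy]) (hw.trans (contents_cons k ks' T ▸ hrot T))
      (inl_not_mem hk' T _)
    have h2 : ((true, .peek k f q, v), ((T k).map .inr ++ contents ks' T) ++ [.inl k]) ∈
        (ofTM2 M).step ((false, .peek k f q, v), .inl k :: ((T k).map .inr ++ contents ks' T)) := by
      simp [step, ofTM2]
    obtain ⟨x, t, ht, hx⟩ := top T ks' k
    obtain ⟨c, hc, h3⟩ := ih (f v (T k).head?) T (t ++ [x]) <| by
      refine List.IsRotated.trans ?_ (hrot T).symm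
      refine (List.isRotated_append (l := t) (l' := [x])).trans ?_
      rw [List.singleton_append, ← ht]
      exact List.isRotated_append
    refine ⟨c, hc, (Relation.TransGen.tail' (h1.tail h2) ?_).trans h3⟩
    rw [ht, ← hx]
    simp [step, ofTM2]
  | pop k f q ih =>
    obtain ⟨ks', hk', hrot⟩ := exists_contents_isRotated (Γ := Γ) hnd (hks k)
    have h1 := reaches_of_isRotated (ofTM2 M) (s := (false, .pop k f q, v)) (x := .inl k)
      (t := (T k).map Sum.inr ++ contents ks' T)
      (fun y hy => by simp [ofTM2, hy]) (hw.trans (contents_cons k ks' T ▸ hrot T))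
      (inl_not_mem hk' T _)
    have h2 : ((true, .pop k f q, v), ((T k).map .inr ++ contents ks' T) ++ [.inl k]) ∈
        (ofTM2 M).step ((false, .pop k f q, v), .inl k :: ((T k).map .inr ++ contents ks' T)) := by
      simp [step, ofTM2]
    obtain ⟨x, t, ht, hx⟩ := top T ks' k
    obtain ⟨c, hc, h3⟩ := ih (f v (T k).head?) (Function.update T k (T k).tail)
      (t ++ if x.isLeft then [x] else []) <| by
        refine List.IsRotated.trans ?_ (hrot _).symm
        rw [contents_cons, contents_update hk', Function.update_self]
        cases hT : T k with
        | nil =>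
          rw [hT] at hx ht
          rcases x with k' | a
          · refine (List.isRotated_append (l := t) (l' := [.inl k'])).trans ?_
            rw [List.singleton_append, ← ht]
            exact List.isRotated_append
          · simp at hx
        | cons a r =>
          rw [hT] at hx ht
          obtain ⟨rfl, rfl⟩ := List.cons.inj ht
          simp only [Sum.isLeft_inr, Bool.false_eq_true, if_false, List.append_nil, List.tail_cons]
          exact List.isRotated_append (l := r.map .inr ++ contents ks' T) (l' := [.inl k])
    refine ⟨c, hc, (Relation.TransGen.tail' (h1.tail h2) ?_).trans h3⟩
    rw [ht, ← hx]
    simp [step, ofTM2]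
  | load f q ih =>
    obtain ⟨w', hw', h1⟩ := turn (.load f q) q v (f v) T w hw fun x => by simp [ofTM2]
    obtain ⟨c, hc, h2⟩ := ih (f v) T w' hw'
    exact ⟨c, hc, h2.head h1⟩
  | branch f q₁ q₂ ih₁ ih₂ =>
    obtain ⟨w', hw', h1⟩ := turn (.branch f q₁ q₂) (cond (f v) q₁ q₂) v v T w hw
      fun x => by simp [ofTM2]
    rw [stepAux]
    cases hf : f v with
    | true =>
      rw [hf] at h1
      obtain ⟨c, hc, h2⟩ := ih₁ v T w' hw'
      exact ⟨c, hc, h2.head h1⟩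
    | false =>
      rw [hf] at h1
      obtain ⟨c, hc, h2⟩ := ih₂ v T w' hw'
      exact ⟨c, hc, h2.head h1⟩
  | goto l =>
    obtain ⟨w', hw', h1⟩ := turn (.goto l) (M (l v)) v v T w hw fun x => by simp [ofTM2]
    exact ⟨_, ⟨rfl, hw'⟩, .single h1⟩
  | halt =>
    have drain : ∀ w : List (K ⊕ Γ), w ≠ [] →
        StateTransition.Reaches₁ (ofTM2 M).step ((false, .halt, v), w) ((false, .halt, v), []) := by
      intro w hw
      induction w with
      | nil => exact absurd rfl hw
      | cons x w ih =>
        have h1 : ((false, .halt, v), w) ∈ (ofTM2 M).step ((false, .halt, v), x :: w) := by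
          simp [step, ofTM2]
        by_cases hw' : w = []
        · subst hw'; exact .single h1
        · exact (ih hw').head h1
    exact ⟨((false, .halt, v), []), rfl, drain w (hne T w hw)⟩

theorem respects_ofTM2 (M : Λ → Stmt (fun _ : K => Γ) Λ σ) {ks : List K} (hnd : ks.Nodup)
    (hks : ∀ k, k ∈ ks) (k₀ : K) :
    StateTransition.Respects (TM2.step M) (ofTM2 M).step (Represents M ks) := by
  rintro ⟨l, v, T⟩ ⟨s, w⟩ h
  cases l with
  | none =>
    obtain rfl : w = [] := h
    rfl
  | some l =>
    obtain ⟨rfl, hw⟩ := h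
    exact exists_represents_stepAux M hnd hks k₀ (M l) v T w hw

/-- The restriction of a queue machine to a set of states that it does not leave. -/
def restrict {S A : Type} (M : QueueMachine S A) (p : S → Prop)
    (h : ∀ s a, p s → p (M s a).1) : QueueMachine {s // p s} A :=
  fun s a => (⟨(M s a).1, h s a s.2⟩, (M s a).2)

omit [DecidableEq K] [DecidableEq Γ] in
theorem output_restrict {S A : Type} (M : QueueMachine S A) (p : S → Prop)
    (h : ∀ s a, p s → p (M s a).1) (s : {s // p s}) (v : List A) :
    (M.restrict p h).output s v = M.output s v := by
  induction v generalizing s with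
  | nil => rfl
  | cons a v ih => simp [output, ih, restrict]

theorem ofTM2_mem_stmts [Inhabited Λ] {M : Λ → Stmt (fun _ : K => Γ) Λ σ} {L : Finset Λ}
    (hL : Supports M L) (s : Bool × Stmt (fun _ : K => Γ) Λ σ × σ) (x : K ⊕ Γ)
    (hs : some s.2.1 ∈ stmts M L) : some (ofTM2 M s x).1.2.1 ∈ stmts M L := by
  obtain ⟨b, q, v⟩ := s
  have sub : ∀ q', q' ∈ stmts₁ q → some q' ∈ stmts M L := fun q' h => stmts_trans h hs
  cases q with
  | push k f q =>
    simp only [ofTM2]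
    split_ifs
    · exact sub _ (by simp [stmts₁, stmts₁_self])
    · exact hs
  | peek k f q => cases b <;> exact sub _ (by simp [ofTM2, stmts₁, stmts₁_self])
  | pop k f q => cases b <;> exact sub _ (by simp [ofTM2, stmts₁, stmts₁_self])
  | load f q => exact sub _ (by simp [ofTM2, stmts₁, stmts₁_self])
  | branch f q₁ q₂ =>
    refine sub _ ?_
    simp only [ofTM2]
    cases f v <;> simp [stmts₁, stmts₁_self]
  | goto l =>
    have hl := stmts_supportsStmt hL hs v
    simp only [ofTM2, stmts, Finset.mem_insertNone, Finset.mem_biUnion, Option.mem_def,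
      Option.some.injEq, forall_eq']
    exact ⟨l v, hl, stmts₁_self⟩
  | halt => exact hs

section Undecidable

open PartrecToTM2

theorem trNat_eq_map_bits (n : ℕ) :
    trNat n = n.bits.map fun b => bif b then Γ'.bit1 else Γ'.bit0 := by
  have pos : ∀ p : PosNum,
      trPosNum p = (p : ℕ).bits.map fun b => bif b then Γ'.bit1 else Γ'.bit0 := by
    intro p
    induction p with
    | one => simp [trPosNum]
    | bit0 p ih =>
      have h : ((PosNum.bit0 p : PosNum) : ℕ) = 2 * (p : ℕ) := by
        rw [PosNum.cast_bit0]; ring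
      rw [h, Nat.bit0_bits _ (PosNum.to_nat_pos p).ne', List.map_cons, ← ih]
      rfl
    | bit1 p ih =>
      have h : ((PosNum.bit1 p : PosNum) : ℕ) = 2 * (p : ℕ) + 1 := by
        rw [PosNum.cast_bit1]; ring
      rw [h, Nat.bit1_bits, List.map_cons, ← ih]
      rfl
  have num : ∀ m : Num, trNum m = (m : ℕ).bits.map fun b => bif b then Γ'.bit1 else Γ'.bit0 := by
    intro m
    cases m with
    | zero => simp [trNum]
    | pos p => exact pos p
  rw [trNat, num, Num.to_of_nat]

/-- There is a queue machine that halts on an undecidable set of queues, which are given by the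
binary digits of a number. -/
theorem exists_undecidable : ∃ (S A : Type) (_ : Fintype S) (_ : DecidableEq S) (_ : Fintype A)
    (_ : DecidableEq A) (M : QueueMachine S A) (s₀ : S) (u w : List A) (φ : Bool → A),
    ¬ ComputablePred fun n : ℕ => ∃ v, (u ++ n.bits.map φ ++ w) ++ M.output s₀ v = v := by
  classical
  have hU : Partrec fun n : ℕ => Nat.Partrec.Code.eval (Denumerable.ofNat Nat.Partrec.Code n) 0 :=
    Nat.Partrec.Code.eval_part.comp (Computable.ofNat _) (Computable.const 0)
  obtain ⟨c, hc⟩ := ToPartrec.Code.exists_code (Nat.Partrec'.part_iff₁.2 hU)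
  let _ : Inhabited Λ' := ⟨trNormal c Cont'.halt⟩
  have hL : Supports tr (codeSupp c Cont'.halt) := tr_supports c Cont'.halt
  set M := ofTM2 (K := K') (Γ := Γ') (Λ := Λ') (σ := Option Γ') tr
  set p : Bool × Stmt (fun _ : K' => Γ') Λ' (Option Γ') × Option Γ' → Prop :=
    fun s => some s.2.1 ∈ stmts tr (codeSupp c Cont'.halt) with hp
  have hMp : ∀ s a, p s → p (M s a).1 := ofTM2_mem_stmts hL
  have hfin : Finite {s // p s} := by
    have : {s | p s} ⊆ Set.univ ×ˢ ((some ⁻¹' (stmts tr (codeSupp c Cont'.halt) :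
        Set (Option (Stmt (fun _ : K' => Γ') Λ' (Option Γ'))))) ×ˢ Set.univ) := by
      rintro ⟨b, q, v⟩ h
      exact ⟨trivial, h, trivial⟩
    refine Set.Finite.subset ?_ this
    exact Set.finite_univ.prod
      ((Set.Finite.preimage (Option.some_injective _).injOn (Finset.finite_toSet _)).prod
        Set.finite_univ)
  have hK : Finite K' := Finite.of_surjective
    (fun i : Fin 4 => ![K'.main, K'.rev, K'.aux, K'.stack] i) fun k => by
      cases k
      exacts [⟨0, rfl⟩, ⟨1, rfl⟩, ⟨2, rfl⟩, ⟨3, rfl⟩]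
  let s₀ : {s // p s} := ⟨(false, tr (trNormal c Cont'.halt), none), by
    simp only [hp, stmts, Finset.mem_insertNone, Finset.mem_biUnion, Option.mem_def,
      Option.some.injEq, forall_eq']
    exact ⟨_, hL.1, stmts₁_self⟩⟩
  refine ⟨{s // p s}, K' ⊕ Γ', Fintype.ofFinite _, inferInstance, Fintype.ofFinite _, inferInstance,
    M.restrict p hMp, s₀, [.inl K'.main],
    [.inr Γ'.cons, .inl K'.rev, .inl K'.aux, .inl K'.stack],
    fun b => .inr (bif b then Γ'.bit1 else Γ'.bit0), fun hcomp => ?_⟩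
  have key : ∀ n : ℕ, (∃ v, ([.inl K'.main] ++
      n.bits.map (fun b => .inr (bif b then Γ'.bit1 else Γ'.bit0)) ++
      [.inr Γ'.cons, .inl K'.rev, .inl K'.aux, .inl K'.stack]) ++
        (M.restrict p hMp).output s₀ v = v) ↔
      (Nat.Partrec.Code.eval (Denumerable.ofNat Nat.Partrec.Code n) 0).Dom := by
    intro n
    simp only [output_restrict]
    rw [← eval_dom_iff]
    have hks : ∀ k, k ∈ [K'.main, K'.rev, K'.aux, K'.stack] := fun k => by cases k <;> simp
    rw [StateTransition.tr_eval_dom (respects_ofTM2 tr (by simp) hks K'.main)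
      (a₁ := PartrecToTM2.init c [n])]
    · rw [PartrecToTM2.tr_eval]
      have := hc ⟨[n], rfl⟩
      simp only at this
      rw [this]
      rfl
    · refine ⟨rfl, ?_⟩
      refine Eq.subst (motive := fun l => l ~r contents _ _) ?_ (List.IsRotated.refl _)
      simp [contents, trNat_eq_map_bits, Function.comp_def]
  refine ComputablePred.halting_problem 0 ?_
  obtain ⟨f, hf, hfp⟩ := ComputablePred.computable_iff.1 hcomp
  refine ComputablePred.computable_iff.2 ⟨fun c => f (Encodable.encode c),
    hf.comp Computable.encode, ?_⟩
  funext c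
  rw [← congrFun hfp (Encodable.encode c), eq_iff_iff, key, Denumerable.ofNat_encode]

end Undecidable

end QueueMachine

/-! ### The automaton that multiplies two-adic vectors by matrices -/

namespace TwoAdic

section Digits

variable {m : ℕ}

/-- The digit of `n` at the place `j` in base `b`. -/
def digit (b n : ℕ) (j : Fin m) : ℕ := n / b ^ (j : ℕ) % b

/-- The number with the digits `f` in base `b`. -/
def ofDigits (b : ℕ) (f : Fin m → ℕ) : ℕ := ∑ j, f j * b ^ (j : ℕ)

theorem digit_lt {b : ℕ} (hb : 0 < b) (n : ℕ) (j : Fin m) : digit b n j < b := Nat.mod_lt _ hb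

theorem ofDigits_lt {b : ℕ} {f : Fin m → ℕ} (hf : ∀ j, f j < b) : ofDigits b f < b ^ m :=
  (finFunctionFinEquiv fun j => ⟨f j, hf j⟩ : Fin (b ^ m)).2

theorem digit_ofDigits {b : ℕ} {f : Fin m → ℕ} (hf : ∀ j, f j < b) (j : Fin m) :
    digit b (ofDigits b f) j = f j := by
  have := congrFun (finFunctionFinEquiv.symm_apply_apply fun j => (⟨f j, hf j⟩ : Fin b)) j
  exact congrArg Fin.val this

theorem eq_of_digit_eq {b n n' : ℕ} (hn : n < b ^ m) (hn' : n' < b ^ m)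
    (h : ∀ j : Fin m, digit b n j = digit b n' j) : n = n' := by
  have := (finFunctionFinEquiv (m := b) (n := m)).symm.injective (a₁ := ⟨n, hn⟩) (a₂ := ⟨n', hn'⟩)
    (funext fun j => Fin.ext (h j))
  exact congrArg Fin.val this

end Digits

section PosNeg

open RightAngled

variable {m : ℕ} (nc : Fin m → Fin m → Prop) [DecidableRel nc]

/-- The action of a generator on differences of vectors of natural numbers. -/
def posNegStep (i : Fin m) (p : (Fin m → ℕ) × (Fin m → ℕ)) : (Fin m → ℕ) × (Fin m → ℕ) :=
  (Function.update p.1 i (4 * (∑ j, if nc i j then p.1 j else 0) + p.2 i),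
    Function.update p.2 i (4 * (∑ j, if nc i j then p.2 j else 0) + p.1 i))

/-- Two vectors of natural numbers with difference `act nc l x`. -/
def posNeg (l : List (Fin m)) (x : Fin m → ℕ) : (Fin m → ℕ) × (Fin m → ℕ) :=
  l.foldr (posNegStep nc) (x, 0)

theorem act_eq_posNeg_sub (l : List (Fin m)) (x : Fin m → ℕ) (j : Fin m) :
    act nc l (fun j => (x j : ℤ)) j = ((posNeg nc l x).1 j : ℤ) - ((posNeg nc l x).2 j : ℤ) := by
  induction l generalizing j with
  | nil => simp [posNeg]
  | cons i l ih =>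
    rw [act_cons, Module.End.mul_apply]
    change _ = (((posNegStep nc i (posNeg nc l x)).1 j : ℕ) : ℤ) -
      (((posNegStep nc i (posNeg nc l x)).2 j : ℕ) : ℤ)
    by_cases hj : j = i
    · subst hj
      rw [refl_apply_self, neighborSum_apply]
      simp only [posNegStep, Function.update_self, ih]
      push_cast
      have : ∀ k, (if nc j k then ((posNeg nc l x).1 k : ℤ) - ((posNeg nc l x).2 k : ℤ) else 0) =
          (if nc j k then ((posNeg nc l x).1 k : ℤ) else 0) -
            (if nc j k then ((posNeg nc l x).2 k : ℤ) else 0) := by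
        intro k; split_ifs <;> simp
      simp only [this, Finset.sum_sub_distrib]
      ring
    · rw [refl_apply_of_ne nc hj, ih]
      simp [posNegStep, hj]

theorem posNeg_le (l : List (Fin m)) {x : Fin m → ℕ} (hx : ∀ j, x j ≤ 1) (j : Fin m) :
    (posNeg nc l x).1 j ≤ (4 * m + 1) ^ l.length ∧
      (posNeg nc l x).2 j ≤ (4 * m + 1) ^ l.length := by
  induction l generalizing j with
  | nil => simpa [posNeg] using hx j
  | cons i l ih =>
    change (posNegStep nc i (posNeg nc l x)).1 j ≤ _ ∧ (posNegStep nc i (posNeg nc l x)).2 j ≤ _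
    have hsum : ∀ f : Fin m → ℕ, (∀ k, f k ≤ (4 * m + 1) ^ l.length) →
        (∑ k, if nc i k then f k else 0) ≤ m * (4 * m + 1) ^ l.length := by
      intro f hf
      refine (Finset.sum_le_sum fun k _ => (?_ : _ ≤ (4 * m + 1) ^ l.length)).trans (by simp)
      split_ifs
      · exact hf k
      · exact Nat.zero_le _
    have h1 := hsum _ fun k => (ih k).1
    have h2 := hsum _ fun k => (ih k).2
    have h3 : (4 * m + 1) ^ (i :: l).length =
        4 * (m * (4 * m + 1) ^ l.length) + (4 * m + 1) ^ l.length := by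
      rw [List.length_cons, pow_succ]; ring
    by_cases hj : j = i
    · subst hj
      simp only [posNegStep, Function.update_self]
      have := ih j
      omega
    · simp only [posNegStep, Function.update_of_ne hj]
      have := ih j
      omega

/-- Every generator acts trivially modulo two. -/
theorem posNeg_add_mod_two (l : List (Fin m)) (x : Fin m → ℕ) (j : Fin m) :
    ((posNeg nc l x).1 j + (posNeg nc l x).2 j) % 2 = x j % 2 := by
  induction l generalizing j with
  | nil => simp [posNeg]
  | cons i l ih =>
    change ((posNegStep nc i (posNeg nc l x)).1 j + (posNegStep nc i (posNeg nc l x)).2 j) % 2 = _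
    rw [← ih j]
    by_cases hj : j = i
    · subst hj
      simp only [posNegStep, Function.update_self]
      omega
    · simp only [posNegStep, Function.update_of_ne hj]

end PosNeg

section Description

open RightAngled MealyAutomaton

variable {m : ℕ} (nc : Fin m → Fin m → Prop) [DecidableRel nc] (ws : List (List (Fin m)))

/-- A bound for the entries of all matrices by which the words in `ws` act. -/
def bound : ℕ := (4 * m + 1) ^ ws.flatten.length

/-- The number of possible carries in each coordinate: the integers from `-bound ws` to
`bound ws`. -/
def base : ℕ := 2 * bound ws + 1

/-- The word of a state. States are numbered in such a way that the digits of the carry vector,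
increased by `bound ws`, are the last `m` digits in the base `base ws`. -/
def stateWord (q : ℕ) : List (Fin m) := ws.getD (q / base ws ^ m) []

/-- The sum of the carry and of the image of the letter `a`, increased by `2 * bound ws`. -/
def total (q a : ℕ) (j : Fin m) : ℕ :=
  digit (base ws) (q % base ws ^ m) j +
    ((posNeg nc (stateWord ws q) (digit 2 a)).1 j + bound ws -
      (posNeg nc (stateWord ws q) (digit 2 a)).2 j)

/-- The letter that the state `q` writes when it reads `a`. -/
def out (q a : ℕ) : ℕ := ofDigits 2 fun j => total nc ws q a j % 2

/-- The state into which the state `q` goes when it reads `a`. -/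
def next (q a : ℕ) : ℕ :=
  (ofDigits (base ws) fun j => total nc ws q a j / 2) + base ws ^ m * (q / base ws ^ m)

/-- The automaton whose states add a carry vector to the action of one of the words in `ws` on
vectors of two-adic integers. Its letters are vectors of `m` binary digits. -/
def description : Description :=
  (ws.length * base ws ^ m, 2 ^ m,
    (List.range (ws.length * base ws ^ m)).flatMap fun q =>
      (List.range (2 ^ m)).map fun a => (q, a, out nc ws q a, next nc ws q a))

variable {nc ws}

theorem base_pos : 0 < base ws := Nat.succ_pos _

theorem posNeg_stateWord_le (q a : ℕ) (j : Fin m) :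
    (posNeg nc (stateWord ws q) (digit 2 a)).1 j ≤ bound ws ∧
      (posNeg nc (stateWord ws q) (digit 2 a)).2 j ≤ bound ws := by
  have hlen : (stateWord ws q).length ≤ ws.flatten.length := by
    rw [stateWord, List.getD_eq_getElem?_getD]
    cases h : ws[q / base ws ^ m]? with
    | none => simp
    | some w => exact (List.sublist_flatten_of_mem (List.mem_of_getElem? h)).length_le
  have hle : (4 * m + 1) ^ (stateWord ws q).length ≤ bound ws :=
    Nat.pow_le_pow_right (Nat.succ_pos _) hlen
  have := posNeg_le nc (stateWord ws q) (x := digit 2 a)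
    (fun j => Nat.le_of_lt_succ (digit_lt (by norm_num) a j)) j
  exact ⟨this.1.trans hle, this.2.trans hle⟩

theorem total_div_two_lt (q a : ℕ) (j : Fin m) : total nc ws q a j / 2 < base ws := by
  have h1 := posNeg_stateWord_le (nc := nc) (ws := ws) q a j
  have h2 := digit_lt (base_pos (ws := ws)) (q % base ws ^ m) j
  simp only [total, base] at h2 ⊢
  omega

theorem out_lt (q a : ℕ) : out nc ws q a < 2 ^ m := ofDigits_lt fun _ => Nat.mod_lt _ (by norm_num)

theorem next_div (q a : ℕ) : next nc ws q a / base ws ^ m = q / base ws ^ m := by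
  have h := ofDigits_lt (total_div_two_lt (nc := nc) (ws := ws) q a)
  rw [next, Nat.add_mul_div_left _ _ (pow_pos base_pos m), Nat.div_eq_of_lt h, zero_add]

theorem next_mod (q a : ℕ) : next nc ws q a % base ws ^ m =
    ofDigits (base ws) fun j => total nc ws q a j / 2 := by
  rw [next, Nat.add_mul_mod_self_left,
    Nat.mod_eq_of_lt (ofDigits_lt (total_div_two_lt (nc := nc) (ws := ws) q a))]

theorem next_lt {q : ℕ} (hq : q < ws.length * base ws ^ m) (a : ℕ) :
    next nc ws q a < ws.length * base ws ^ m := by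
  rw [← Nat.div_lt_iff_lt_mul (pow_pos base_pos m)] at hq ⊢
  rwa [next_div]

theorem stateWord_next (q a : ℕ) : stateWord ws (next nc ws q a) = stateWord ws q := by
  rw [stateWord, next_div, stateWord]

theorem mem_description {q a b p : ℕ} : (q, a, b, p) ∈ (description nc ws).2.2 ↔
    (q < ws.length * base ws ^ m ∧ a < 2 ^ m) ∧ b = out nc ws q a ∧ p = next nc ws q a := by
  simp only [description, List.mem_flatMap, List.mem_range, List.mem_map, Prod.mk.injEq]
  constructor
  · rintro ⟨q, hq, a, ha, rfl, rfl, rfl, rfl⟩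
    exact ⟨⟨hq, ha⟩, rfl, rfl⟩
  · rintro ⟨⟨hq, ha⟩, rfl, rfl⟩
    exact ⟨q, hq, a, ha, rfl, rfl, rfl, rfl⟩

theorem mem_trans {q p : Fin (description nc ws).1} {a b : Fin (description nc ws).2.1} :
    (q, a, b, p) ∈ (description nc ws).toAutomaton.trans ↔
      (b : ℕ) = out nc ws q a ∧ (p : ℕ) = next nc ws q a :=
  mem_description.trans (and_iff_right ⟨q.2, a.2⟩)

theorem wellFormed_description (hws : ws ≠ []) : (description nc ws).WellFormed := by
  refine ⟨Nat.mul_pos (List.length_pos_of_ne_nil hws) (pow_pos base_pos m), pow_pos two_pos m, ?_⟩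
  rintro ⟨q, a, b, p⟩ h
  obtain ⟨⟨hq, ha⟩, rfl, rfl⟩ := mem_description.1 h
  exact ⟨hq, ha, out_lt _ _, next_lt hq _⟩

/-- Since the words act trivially modulo two, a state changes the digits of a letter only by
adding the parities of the carries. -/
theorem out_injective {q a a' : ℕ} (ha : a < 2 ^ m) (ha' : a' < 2 ^ m)
    (h : out nc ws q a = out nc ws q a') : a = a' := by
  refine eq_of_digit_eq ha ha' fun j => ?_
  have hd : ∀ a, digit 2 (out nc ws q a) j = total nc ws q a j % 2 := fun a =>
    digit_ofDigits (fun _ => Nat.mod_lt _ (by norm_num)) j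
  have h1 := hd a
  rw [h, hd a', total, total] at h1
  have h2 := posNeg_add_mod_two nc (stateWord ws q) (digit 2 a) j
  have h3 := posNeg_add_mod_two nc (stateWord ws q) (digit 2 a') j
  have h4 := posNeg_stateWord_le (nc := nc) (ws := ws) q a j
  have h5 := posNeg_stateWord_le (nc := nc) (ws := ws) q a' j
  have h6 := digit_lt (show 0 < 2 by norm_num) a j
  have h7 := digit_lt (show 0 < 2 by norm_num) a' j
  omega

theorem isGAutomaton_description : (description nc ws).toAutomaton.IsGAutomaton where
  complete q a := ⟨⟨_, out_lt _ _⟩, ⟨_, next_lt q.2 _⟩, mem_trans.2 ⟨rfl, rfl⟩⟩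
  deterministic q a b p b' p' h h' := by
    rw [mem_trans] at h h'
    exact ⟨Fin.ext (h.1.trans h'.1.symm), Fin.ext (h.2.trans h'.2.symm)⟩
  inverse_deterministic q b a p a' p' h h' := by
    replace h := mem_trans.1 h
    replace h' := mem_trans.1 h'
    have := Fin.ext (out_injective a.2 a'.2 (h.1.symm.trans h'.1))
    subst this
    exact ⟨rfl, Fin.ext (h.2.trans h'.2.symm)⟩

end Description

end TwoAdic

/-! ### Positive relations of the automaton -/

namespace TwoAdic

open RightAngled MealyAutomaton

variable {m : ℕ} {nc : Fin m → Fin m → Prop} [DecidableRel nc] {ws : List (List (Fin m))}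

/-- The vector of digits of a letter. -/
def letterVec (a : ℕ) : Fin m → ℤ := fun j => (digit 2 a j : ℤ)

/-- The vector of integers whose binary digits are the letters of a word. -/
def value {k : ℕ} : List (Fin k) → (Fin m → ℤ)
  | [] => 0
  | a :: u => letterVec a + (2 : ℤ) • value u

/-- The carry vector of a state. -/
def carry (ws : List (List (Fin m))) (q : ℕ) : Fin m → ℤ :=
  fun j => (digit (base ws) (q % base ws ^ m) j : ℤ) - bound ws

/-- A transition performs the addition with carry in the lowest place. -/
theorem act_letterVec_add_carry (q a : ℕ) :
    act nc (stateWord ws q) (letterVec a) + carry ws q =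
      letterVec (out nc ws q a) + (2 : ℤ) • carry ws (next nc ws q a) := by
  funext j
  have h1 := posNeg_stateWord_le (nc := nc) (ws := ws) q a j
  have h2 : digit 2 (out nc ws q a) j = total nc ws q a j % 2 :=
    digit_ofDigits (fun _ => Nat.mod_lt _ (by norm_num)) j
  have h3 : digit (base ws) (next nc ws q a % base ws ^ m) j = total nc ws q a j / 2 := by
    rw [next_mod]
    exact digit_ofDigits (total_div_two_lt q a) j
  have h4 : act nc (stateWord ws q) (letterVec a) j = _ :=
    act_eq_posNeg_sub nc (stateWord ws q) (digit 2 a) j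
  simp only [Pi.add_apply, Pi.smul_apply, smul_eq_mul, h4]
  simp only [letterVec, carry, h2, h3, total]
  omega

theorem value_of_outputs {q : Fin (description nc ws).1} {u v : List (Fin (description nc ws).2.1)}
    (h : (description nc ws).toAutomaton.Outputs q u v) :
    v.length = u.length ∧ ∃ z : Fin m → ℤ,
      act nc (stateWord ws q) (value u) + carry ws q = value v + (2 : ℤ) ^ u.length • z := by
  induction h with
  | nil q => exact ⟨rfl, carry ws q, by simp [value]⟩
  | @cons q p a b u v ht _ ih =>
    obtain ⟨hlen, z, hz⟩ := ih
    refine ⟨by simp [hlen], z, ?_⟩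
    obtain ⟨hb, hp⟩ := mem_trans.1 ht
    rw [hp, stateWord_next] at hz
    rw [value, value, map_add, map_smul, add_right_comm, act_letterVec_add_carry, ← hb,
      add_assoc, ← smul_add, add_comm (carry ws _), hz, List.length_cons, pow_succ', smul_add,
      smul_smul, add_assoc]

/-- A product of states acts as an affine map on vectors of two-adic integers. -/
theorem value_prod_perm (w : List (Fin (description nc ws).1)) :
    ∃ c : Fin m → ℤ, ((∀ q ∈ w, carry ws (q : ℕ) = 0) → c = 0) ∧
      ∀ u : List (Fin (description nc ws).2.1),
        ((w.map (isGAutomaton_description (nc := nc) (ws := ws)).perm).prod u).length = u.length ∧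
        ∃ z : Fin m → ℤ,
          act nc (w.flatMap fun q : Fin (description nc ws).1 => stateWord ws (q : ℕ)) (value u) +
              c =
            value ((w.map (isGAutomaton_description (nc := nc) (ws := ws)).perm).prod u) +
              (2 : ℤ) ^ u.length • z := by
  induction w with
  | nil => exact ⟨0, fun _ => rfl, fun u => ⟨rfl, 0, by simp⟩⟩
  | cons q w ih =>
    obtain ⟨c, hc, h⟩ := ih
    refine ⟨act nc (stateWord ws q) c + carry ws q, fun h0 => ?_, fun u => ?_⟩
    · rw [hc fun q' hq' => h0 q' (by simp [hq']), h0 q (by simp), map_zero, zero_add]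
    · obtain ⟨hlen, z, hz⟩ := h u
      rw [List.map_cons, List.prod_cons, Equiv.Perm.mul_apply]
      obtain ⟨hlen', z', hz'⟩ := value_of_outputs
        ((isGAutomaton_description (nc := nc) (ws := ws)).outputs_act q
          ((w.map (isGAutomaton_description (nc := nc) (ws := ws)).perm).prod u))
      refine ⟨hlen'.trans hlen, act nc (stateWord ws q) z + z', ?_⟩
      rw [List.flatMap_cons, act_append, Module.End.mul_apply, ← add_assoc, ← map_add, hz, map_add,
        map_smul, add_right_comm, hz', hlen, smul_add, add_assoc, add_comm (_ • z')]
      rfl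

theorem eq_zero_of_two_pow_dvd {x : ℤ} (h : ∀ L : ℕ, (2 : ℤ) ^ L ∣ x) : x = 0 := by
  refine Int.eq_zero_of_abs_lt_dvd (h x.natAbs) ?_
  rw [Int.abs_eq_natAbs]
  exact_mod_cast Nat.lt_two_pow_self

/-- A word is determined by its length `L` and by its value modulo `2 ^ L`. -/
theorem value_injective {k : ℕ} (hk : k ≤ 2 ^ m) {u v : List (Fin k)} (hlen : v.length = u.length)
    {z : Fin m → ℤ} (h : value u = value v + (2 : ℤ) ^ u.length • z) : u = v := by
  induction u generalizing v with
  | nil => exact (List.length_eq_zero_iff.1 hlen).symm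
  | cons a u ih =>
    cases v with
    | nil => simp at hlen
    | cons b v =>
      have hj : ∀ j, letterVec (a : ℕ) j + 2 * value u j =
          letterVec (b : ℕ) j + 2 * value v j + 2 * (2 ^ u.length * z j) := by
        intro j
        have := congrFun h j
        simp only [value, Pi.add_apply, Pi.smul_apply, smul_eq_mul, List.length_cons, pow_succ',
          mul_assoc] at this
        exact this
      have hd : ∀ j : Fin m, digit 2 (a : ℕ) j = digit 2 (b : ℕ) j := by
        intro j
        have h1 := hj j
        have h2 := digit_lt (show 0 < 2 by norm_num) a j
        have h3 := digit_lt (show 0 < 2 by norm_num) b j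
        simp only [letterVec] at h1
        omega
      obtain rfl : a = b := Fin.ext (eq_of_digit_eq (a.2.trans_le hk) (b.2.trans_le hk) hd)
      congr 1
      refine ih (by simpa using hlen) (funext fun j => ?_)
      have := hj j
      simp only [Pi.add_apply, Pi.smul_apply, smul_eq_mul]
      linarith

theorem coe_prod_gen {Q A : Type} [Finite A] {T : MealyAutomaton Q A} (hT : T.IsGAutomaton)
    (w : List Q) : (((w.map hT.gen).prod : hT.group) : Equiv.Perm (List A)) =
      (w.map hT.perm).prod := by
  rw [← Subgroup.subtype_apply, map_list_prod, List.map_map]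
  rfl

/-- The words of a positive relation multiply to a matrix that fixes the all-ones vector. -/
theorem act_one_of_mem_positiveRelations {w : List (Fin (description nc ws).1)}
    (hw : w ∈ (isGAutomaton_description (nc := nc) (ws := ws)).positiveRelations) :
    act nc (w.flatMap fun q : Fin (description nc ws).1 => stateWord ws (q : ℕ)) 1 = 1 := by
  have hprod : (w.map (isGAutomaton_description (nc := nc) (ws := ws)).perm).prod = 1 := by
    rw [← coe_prod_gen, hw.2]
    rfl
  obtain ⟨c, -, h⟩ := value_prod_perm w
  simp only [hprod, Equiv.Perm.one_apply] at h
  have two_pow : 0 < 2 ^ m := by positivity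
  have hzero : ∀ L, value (m := m)
      (List.replicate L (⟨0, two_pow⟩ : Fin (description nc ws).2.1)) = 0 := by
    intro L
    induction L with
    | zero => rfl
    | succ L ih =>
      rw [List.replicate_succ, value, ih]
      funext j
      simp [letterVec, digit]
  have hc : c = 0 := by
    funext j
    refine eq_zero_of_two_pow_dvd fun L => ?_
    obtain ⟨-, z, hz⟩ := h (List.replicate L ⟨0, two_pow⟩)
    rw [hzero, map_zero, zero_add, zero_add, List.length_replicate] at hz
    exact ⟨z j, congrFun hz j⟩
  -- the letter all of whose digits are one, followed by zeros, has the all-ones vector as value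
  have hone : ∃ a : Fin (description nc ws).2.1, letterVec (m := m) (a : ℕ) = 1 := by
    refine ⟨⟨ofDigits 2 fun _ => 1, ofDigits_lt fun _ => by norm_num⟩, funext fun j => ?_⟩
    simp only [letterVec]
    rw [digit_ofDigits (fun _ => by norm_num)]
    rfl
  obtain ⟨a, ha⟩ := hone
  funext j
  refine sub_eq_zero.1 (eq_zero_of_two_pow_dvd fun L => ?_)
  obtain ⟨-, z, hz⟩ := h (a :: List.replicate L ⟨0, two_pow⟩)
  rw [value, hzero, smul_zero, add_zero, hc, add_zero, ha, List.length_cons,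
    List.length_replicate] at hz
  refine (pow_dvd_pow 2 L.le_succ).trans ⟨z j, ?_⟩
  rw [hz]
  simp

/-- If some words have a trivial product, then the states with these words and with carry zero form
a positive relation. -/
theorem exists_positiveRelation {ts : List (List (Fin m))} (hne : ts ≠ []) (hts : ts ⊆ ws)
    (h : act nc ts.flatten = 1) :
    (isGAutomaton_description (nc := nc) (ws := ws)).positiveRelations ≠ ∅ := by
  -- the state with a given word and with carry zero
  have hstate : ∀ t ∈ ts, ∃ q : Fin (description nc ws).1,
      stateWord ws (q : ℕ) = t ∧ carry ws (q : ℕ) = 0 := by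
    intro t ht
    obtain ⟨i, hi, rfl⟩ := List.getElem_of_mem (hts ht)
    have hb : ∀ j : Fin m, (fun _ : Fin m => bound ws) j < base ws := fun _ => by
      simp only [base]; omega
    have hlt := ofDigits_lt hb
    have hdiv : (ofDigits (base ws) (fun _ : Fin m => bound ws) + base ws ^ m * i) / base ws ^ m
        = i := by
      rw [Nat.add_mul_div_left _ _ (pow_pos base_pos m), Nat.div_eq_of_lt hlt, zero_add]
    refine ⟨⟨ofDigits (base ws) (fun _ : Fin m => bound ws) + base ws ^ m * i, ?_⟩, ?_, ?_⟩
    · change _ < ws.length * base ws ^ m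
      rwa [← Nat.div_lt_iff_lt_mul (pow_pos base_pos m), hdiv]
    · simp only [stateWord]
      rw [hdiv, List.getD_eq_getElem _ _ hi]
    · funext j
      simp only [carry, Pi.zero_apply]
      rw [Nat.add_mul_mod_self_left, Nat.mod_eq_of_lt hlt, digit_ofDigits hb]
      simp
  obtain ⟨t₀, ht₀⟩ := List.exists_mem_of_ne_nil ts hne
  have : Nonempty (Fin (description nc ws).1) := ⟨(hstate t₀ ht₀).choose⟩
  choose! f hf hf0 using hstate
  set w := ts.map f with hw
  have hflat : (w.flatMap fun q : Fin (description nc ws).1 => stateWord ws (q : ℕ)) =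
      ts.flatten := by
    rw [hw, List.flatMap_map, List.flatMap_congr (g := id) fun t ht => hf t ht, List.flatMap_id]
  obtain ⟨c, hc, hval⟩ := value_prod_perm (nc := nc) w
  have hc0 : c = 0 := hc fun q hq => by
    obtain ⟨t, ht, rfl⟩ := List.mem_map.1 hq
    exact hf0 t ht
  refine Set.nonempty_iff_ne_empty.1 ⟨w, by simpa [hw] using hne, Subtype.ext ?_⟩
  rw [coe_prod_gen]
  refine Equiv.ext fun u => ?_
  obtain ⟨hlen, z, hz⟩ := hval u
  rw [hflat, h, hc0, add_zero, Module.End.one_apply] at hz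
  exact (value_injective (le_refl _) hlen hz).symm

end TwoAdic

/-! ### Computability of the reduction -/

namespace TwoAdic

open RightAngled MealyAutomaton

section Primrec

theorem primrec_pow : Primrec₂ ((· ^ ·) : ℕ → ℕ → ℕ) := Primrec₂.unpaired'.1 Nat.Primrec.pow

/-- The list of binary digits of `n` is computed from that of `n / 2`. -/
theorem primrec_bits : Primrec Nat.bits := by
  have h : Primrec₂ fun (_ : Unit) (n : ℕ) => n.bits := by
    refine Primrec.nat_strong_rec _ (g := fun _ l => if l.length = 0 then some [] else
      (l[l.length / 2]?).map (List.cons (decide (l.length % 2 = 1)))) ?_ ?_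
    · have hlen : Primrec fun p : Unit × List (List Bool) => p.2.length :=
        Primrec.list_length.comp Primrec.snd
      refine Primrec.ite (Primrec.eq.comp hlen (Primrec.const 0)) (Primrec.const _) ?_
      refine Primrec.option_map
        (Primrec.list_getElem?.comp Primrec.snd (Primrec.nat_div.comp hlen (Primrec.const 2))) ?_
      refine Primrec.list_cons.comp ?_ Primrec.snd
      exact (Primrec.eq.comp (Primrec.nat_mod.comp (hlen.comp Primrec.fst) (Primrec.const 2))
        (Primrec.const 1)).decide
    · intro _ n
      simp only [List.length_map, List.length_range]
      by_cases hn : n = 0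
      · simp [hn]
      rw [if_neg hn, List.getElem?_map, List.getElem?_range (by omega)]
      simp only [Option.map_some, Option.some.injEq]
      rcases Nat.even_or_odd' n with ⟨k, rfl | rfl⟩
      · rw [Nat.bit0_bits k (by omega)]
        simp
      · rw [Nat.bit1_bits k]
        simp [show (2 * k + 1) / 2 = k by omega, show (2 * k + 1) % 2 = 1 by omega]
  exact h.comp (Primrec.const ()) Primrec.id

variable {α : Type} [Primcodable α] {m : ℕ}

theorem primrec_sum {ι : Type} (s : Finset ι) {f : ι → α → ℕ} (hf : ∀ j, Primrec (f j)) :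
    Primrec fun a => ∑ j ∈ s, f j a := by
  classical
  induction s using Finset.induction_on with
  | empty => simpa using Primrec.const 0
  | insert j s hj ih =>
    simp only [Finset.sum_insert hj]
    exact Primrec.nat_add.comp (hf j) ih

theorem primrec_vec {σ : Type} [Primcodable σ] {f : Fin m → α → σ} (hf : ∀ j, Primrec (f j)) :
    Primrec fun a j => f j a :=
  Primrec.fin_curry.2 (Primrec.fin_curry₁.2 hf).swap

theorem primrec_apply {σ : Type} [Primcodable σ] {f : α → Fin m → σ} {j : α → Fin m}
    (hf : Primrec f) (hj : Primrec j) : Primrec fun a => f a (j a) :=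
  Primrec.fin_app.comp hf hj

theorem primrec_digit {b n : α → ℕ} (hb : Primrec b) (hn : Primrec n) (j : Fin m) :
    Primrec fun a => digit (b a) (n a) j :=
  Primrec.nat_mod.comp (Primrec.nat_div.comp hn (primrec_pow.comp hb (Primrec.const _))) hb

theorem primrec_ofDigits {b : α → ℕ} {f : Fin m → α → ℕ} (hb : Primrec b)
    (hf : ∀ j, Primrec (f j)) : Primrec fun a => ofDigits (b a) fun j => f j a :=
  primrec_sum _ fun j => Primrec.nat_mul.comp (hf j) (primrec_pow.comp hb (Primrec.const _))

variable (nc : Fin m → Fin m → Prop) [DecidableRel nc]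

theorem primrec_posNegStep : Primrec₂ (posNegStep nc) := by
  have half : ∀ (x y : Fin m × (Fin m → ℕ) × (Fin m → ℕ) → Fin m → ℕ), Primrec x → Primrec y →
      Primrec fun p => Function.update (x p) p.1
        (4 * (∑ j, if nc p.1 j then x p j else 0) + y p p.1) := by
    intro x y hx hy
    refine primrec_vec fun k => ?_
    simp only [Function.update_apply]
    refine Primrec.ite (Primrec.eq.comp (Primrec.const k) Primrec.fst) ?_
      (primrec_apply hx (Primrec.const k))
    refine Primrec.nat_add.comp (Primrec.nat_mul.comp (Primrec.const 4) (primrec_sum _ fun j => ?_))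
      (primrec_apply hy Primrec.fst)
    have hd : Primrec fun i : Fin m => decide (nc i j) := Primrec.dom_finite _
    exact Primrec.ite (c := fun p : Fin m × (Fin m → ℕ) × (Fin m → ℕ) => nc p.1 j)
      ⟨inferInstance, hd.comp Primrec.fst⟩ (primrec_apply hx (Primrec.const j)) (Primrec.const 0)
  exact Primrec.pair
    (half _ _ (Primrec.fst.comp Primrec.snd) (Primrec.snd.comp Primrec.snd))
    (half _ _ (Primrec.snd.comp Primrec.snd) (Primrec.fst.comp Primrec.snd))

theorem primrec_posNeg {l : α → List (Fin m)} {x : α → Fin m → ℕ} (hl : Primrec l)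
    (hx : Primrec x) : Primrec fun a => posNeg nc (l a) (x a) :=
  Primrec.list_foldr (h := fun _ p => posNegStep nc p.1 p.2) hl
    (Primrec.pair hx (Primrec.const 0))
    ((primrec_posNegStep nc).comp (Primrec.fst.comp Primrec.snd) (Primrec.snd.comp Primrec.snd))

theorem primrec_bound : Primrec (bound (m := m)) :=
  primrec_pow.comp (Primrec.const _) (Primrec.list_length.comp Primrec.list_flatten)

theorem primrec_base : Primrec (base (m := m)) :=
  Primrec.succ.comp (Primrec.nat_mul.comp (Primrec.const 2) primrec_bound)

theorem primrec_description : Primrec (description (m := m) nc) := by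
  have hpow : Primrec fun ws : List (List (Fin m)) => base ws ^ m :=
    primrec_pow.comp primrec_base (Primrec.const m)
  have hN : Primrec fun ws : List (List (Fin m)) => ws.length * base ws ^ m :=
    Primrec.nat_mul.comp Primrec.list_length hpow
  have hws : Primrec fun p : (List (List (Fin m)) × ℕ) × ℕ => p.1.1 :=
    Primrec.fst.comp Primrec.fst
  have hq : Primrec fun p : (List (List (Fin m)) × ℕ) × ℕ => p.1.2 :=
    Primrec.snd.comp Primrec.fst
  have hdiv := Primrec.nat_div.comp hq (hpow.comp hws)
  have hpn : Primrec fun p : (List (List (Fin m)) × ℕ) × ℕ =>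
      posNeg nc (stateWord p.1.1 p.1.2) (digit 2 p.2) :=
    primrec_posNeg nc ((Primrec.list_getD []).comp hws hdiv)
      (primrec_vec fun j => primrec_digit (Primrec.const 2) Primrec.snd j)
  have htotal : ∀ j : Fin m, Primrec fun p : (List (List (Fin m)) × ℕ) × ℕ =>
      total nc p.1.1 p.1.2 p.2 j := fun j =>
    Primrec.nat_add.comp
      (primrec_digit (primrec_base.comp hws) (Primrec.nat_mod.comp hq (hpow.comp hws)) j)
      (Primrec.nat_sub.comp
        (Primrec.nat_add.comp (primrec_apply (Primrec.fst.comp hpn) (Primrec.const j))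
          (primrec_bound.comp hws))
        (primrec_apply (Primrec.snd.comp hpn) (Primrec.const j)))
  have hout : Primrec fun p : (List (List (Fin m)) × ℕ) × ℕ => out nc p.1.1 p.1.2 p.2 :=
    primrec_ofDigits (Primrec.const 2) fun j => Primrec.nat_mod.comp (htotal j) (Primrec.const 2)
  have hnext : Primrec fun p : (List (List (Fin m)) × ℕ) × ℕ => next nc p.1.1 p.1.2 p.2 :=
    Primrec.nat_add.comp
      (primrec_ofDigits (primrec_base.comp hws) fun j =>
        Primrec.nat_div.comp (htotal j) (Primrec.const 2))
      (Primrec.nat_mul.comp (hpow.comp hws) hdiv)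
  refine Primrec.pair hN (Primrec.pair (Primrec.const _) ?_)
  refine Primrec.list_flatMap (Primrec.list_range.comp hN) ?_
  refine Primrec.list_map (Primrec.const (List.range (2 ^ m))) ?_
  exact Primrec.pair hq (Primrec.pair Primrec.snd (Primrec.pair hout hnext))

end Primrec

end TwoAdic

namespace RightAngled

/-- Renaming the generators. -/
theorem act_map_equiv {V W : Type} [Fintype V] [DecidableEq V] [Fintype W] [DecidableEq W]
    (nc : V → V → Prop) [DecidableRel nc] (e : V ≃ W) (l : List V) (x : V → ℤ) :
    act (fun i j => nc (e.symm i) (e.symm j)) (l.map e) (x ∘ e.symm) = act nc l x ∘ e.symm := by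
  induction l with
  | nil => rfl
  | cons a l ih =>
    rw [List.map_cons, act_cons, act_cons, Module.End.mul_apply, Module.End.mul_apply, ih]
    funext j
    by_cases hj : j = e a
    · subst hj
      rw [refl_apply_self, neighborSum_apply, Function.comp_apply, Function.comp_apply,
        e.symm_apply_apply, refl_apply_self, neighborSum_apply]
      congr 2
      exact Fintype.sum_equiv e.symm _ _ fun i => rfl
    · rw [refl_apply_of_ne _ hj, Function.comp_apply, Function.comp_apply,
        refl_apply_of_ne nc fun h => hj (by rw [← h, e.apply_symm_apply])]

end RightAngled

namespace QueueMachine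

open RightAngled TwoAdic

variable {S A : Type} [Fintype S] [DecidableEq S] [Fintype A] [DecidableEq A]
  (M : QueueMachine S A) (s₀ : S)

/-- The words of all tiles, over an alphabet of numbers. -/
noncomputable def tileWords {m : ℕ} (e : Gen S A ≃ Fin m) (w : List A) : List (List (Fin m)) :=
  (Finset.univ : Finset (Tile S A)).toList.map fun t => (t.word M s₀ w).map e

/-- The automaton for the tiles has a positive relation if and only if the queue machine halts. -/
theorem positiveRelations_tileWords_eq_empty_iff {m : ℕ} (e : Gen S A ≃ Fin m) (w : List A) :
    (isGAutomaton_description (nc := fun i j => NC (e.symm i) (e.symm j))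
      (ws := tileWords M s₀ e w)).positiveRelations = ∅ ↔ ¬ ∃ v, w ++ M.output s₀ v = v := by
  rw [iff_not_comm]
  constructor
  · rintro ⟨v, hv⟩
    obtain ⟨ts, hne, hact⟩ := Tile.exists_act_words_eq_one hv
    refine exists_positiveRelation (ts := ts.map fun t => (t.word M s₀ w).map e)
      (by simpa using hne) ?_ ?_
    · intro t ht
      obtain ⟨t, -, rfl⟩ := List.mem_map.1 ht
      exact List.mem_map.2 ⟨t, by simp, rfl⟩
    · rw [← List.flatMap_def, ← List.map_flatMap]
      refine LinearMap.ext fun x => ?_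
      have := act_map_equiv NC e (ts.flatMap (Tile.word M s₀ w)) (x ∘ e)
      rw [hact, Module.End.one_apply, Function.comp_assoc, e.self_comp_symm, Function.comp_id]
        at this
      exact this
  · intro h
    obtain ⟨w', hw'⟩ := Set.nonempty_iff_ne_empty.2 h
    have hact := act_one_of_mem_positiveRelations hw'
    have hne := hw'.1
    -- every state belongs to a tile
    have htile : ∀ q ∈ w', ∃ t : Tile S A,
        stateWord (tileWords M s₀ e w) (q : ℕ) = (t.word M s₀ w).map e := by
      intro q _
      have hlt : (q : ℕ) / base (tileWords M s₀ e w) ^ m < (tileWords M s₀ e w).length :=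
        (Nat.div_lt_iff_lt_mul (pow_pos base_pos m)).2 q.2
      have hmem : stateWord (tileWords M s₀ e w) (q : ℕ) ∈ tileWords M s₀ e w := by
        rw [stateWord, List.getD_eq_getElem _ _ hlt]
        exact List.getElem_mem hlt
      obtain ⟨t, -, ht⟩ := List.mem_map.1 hmem
      exact ⟨t, ht.symm⟩
    have : Nonempty (Tile S A) := ⟨Tile.start⟩
    choose! f hf using htile
    refine Tile.halts_of_act_words (ts := w'.map f) (by simpa using hne) ?_
    have hflat : (w'.flatMap fun q : Fin (description (fun i j => NC (e.symm i) (e.symm j))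
        (tileWords M s₀ e w)).1 => stateWord (tileWords M s₀ e w) (q : ℕ)) =
        ((w'.map f).flatMap (Tile.word M s₀ w)).map e := by
      rw [List.map_flatMap, List.flatMap_map]
      exact List.flatMap_congr hf
    rw [hflat] at hact
    have key := act_map_equiv NC e ((w'.map f).flatMap (Tile.word M s₀ w)) 1
    funext i
    have := congrFun (key.symm.trans hact) (e i)
    simpa using this

omit [DecidableEq S] [DecidableEq A] in
/-- The words of the tiles can be computed if the initial queue is given by binary digits. -/
theorem computable_tileWords {m : ℕ} (e : Gen S A ≃ Fin m) (u w : List A) (φ : Bool → A) :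
    Computable fun n : ℕ => tileWords M s₀ e (u ++ n.bits.map φ ++ w) := by
  refine Primrec.to_comp ?_
  have tile : ∀ t : Tile S A,
      Primrec fun n : ℕ => (t.word M s₀ (u ++ n.bits.map φ ++ w)).map e := by
    intro t
    cases t with
    | start =>
      have h : Primrec fun n : ℕ => n.bits.flatMap fun b => (enc (S := S) true [φ b]).map e :=
        Primrec.list_flatMap primrec_bits
          ((Primrec.dom_finite fun b => (enc (S := S) true [φ b]).map e).comp Primrec.snd)
      refine ((Primrec.list_append.comp (Primrec.list_append.comp
        (Primrec.const ((enc (S := S) true u).map e)) h)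
        (Primrec.const ((enc true w ++ [Sum.inr (Node.state s₀)]).map e)))).of_eq fun n => ?_
      have hbits : enc (S := S) true (n.bits.map φ) = n.bits.flatMap fun b => enc true [φ b] := by
        rw [enc, List.flatMap_map]
        rfl
      simp only [Tile.word, Tile.src, Tile.tgt, Tile.lead, Tile.body, enc_append, hbits,
        List.map_append, List.map_flatMap, List.nil_append, List.append_assoc]
    | step s a => exact Primrec.const ((Tile.word M s₀ [] (.step s a)).map e)
    | switch s => exact Primrec.const ((Tile.word M s₀ [] (.switch s)).map e)
    | pop a => exact Primrec.const ((Tile.word M s₀ [] (.pop a)).map e)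
    | close => exact Primrec.const ((Tile.word M s₀ [] .close).map e)
  have list : ∀ l : List (Tile S A),
      Primrec fun n : ℕ => l.map fun t => (t.word M s₀ (u ++ n.bits.map φ ++ w)).map e := by
    intro l
    induction l with
    | nil => exact Primrec.const []
    | cons t l ih => exact Primrec.list_cons.comp (tile t) ih
  exact list _

end QueueMachine

theorem mainTheorem1 :
    ¬ DecidableProblem (fun T : MealyAutomaton.GDescription => T.desc)
      (fun T => T.isGAutomaton.positiveRelations = ∅) := by
  rintro ⟨f, hf, hcorrect⟩
  obtain ⟨S, A, _, _, _, _, M, s₀, u, w, φ, hundec⟩ := QueueMachine.exists_undecidable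
  let e := Fintype.equivFin (QueueMachine.Gen S A)
  let ws : ℕ → List (List (Fin _)) := fun n => M.tileWords s₀ e (u ++ n.bits.map φ ++ w)
  have hne : ∀ n, ws n ≠ [] := fun n h =>
    (Finset.univ_nonempty_iff.2 ⟨.start⟩).ne_empty (Finset.toList_eq_nil.1 (List.map_eq_nil_iff.1 h))
  let T : ℕ → MealyAutomaton.GDescription := fun n =>
    ⟨TwoAdic.description (fun i j => QueueMachine.NC (e.symm i) (e.symm j)) (ws n),
      TwoAdic.wellFormed_description (hne n), TwoAdic.isGAutomaton_description⟩
  have hT : Computable fun n => (T n).desc :=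
    (TwoAdic.primrec_description _).to_comp.comp (M.computable_tileWords s₀ e u w φ)
  have hiff : ∀ n, (T n).isGAutomaton.positiveRelations = ∅ ↔
      ¬ ∃ v, (u ++ n.bits.map φ ++ w) ++ M.output s₀ v = v := fun n =>
    M.positiveRelations_tileWords_eq_empty_iff s₀ e _
  choose answer hans hcor using fun n => hcorrect (T n)
  have hanswer : Computable answer := (hf.comp hT).of_eq fun n => Part.eq_some_iff.2 (hans n)
  refine hundec (ComputablePred.computable_iff.2 ⟨fun n => !answer n,
    (Primrec.dom_finite _).to_comp.comp hanswer, ?_⟩)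
  funext n
  have := (hcor n).trans (hiff n)
  rw [eq_iff_iff, ← not_iff_not, ← this]
  simp
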